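/- **Setting (the Aleph protocol).** There are $N=3f+1$ nodes, at least $2f+1$ of them honest. A *unit* has a creator, data and a set of parent units; its *round* is $0$ if it has no parents and otherwise one plus the maximal round of a parent. Write $U_0<U$ if $U_0$ is reached from $U$ through parent pointers, and $\downarrow U$ for the parents of $U$ of round one less than that of $U$. A unit is *valid* if its parents have pairwise distinct creators and, when its round is $r>0$, at least $2f+1$ parents have round $r-1$. An adversary schedules the execution, step by step: nodes create valid units whose parents exist, and units are broadcast by an ideal reliable broadcast (at most one unit per creator and round) and added, in an order and with delays chosen by the adversary, to the local copies of nodes that already hold all their parents. An honest node creates one unit for each $r=0,1,2,\dots$, as soon as scheduled after its local copy has $\ge 2f+1$ units of round $r-1$ (if $r>0$), with the maximal unit of round $<r$ of every node in its copy as parents; dishonest nodes are otherwise unrestricted. The height of a local copy is its maximal round. **Randomness.** For each round $r$ there is one secret $x_r$ (SecretBits, independent of its node index). It is available in a local copy once this contains a unit of round $r+1$. The adversary may evaluate $\mathrm{hash}(x_r)$ and $\mathrm{hash}(x_r\|U)$ only after some honest node has created a unit of round $r$. All values $\mathrm{hash}(x_r),\mathrm{hash}(x_r\|U)$ are independent and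 uniform in $\{0,1\}^\lambda$ (random oracle), where $\lambda\ge 1$ and $N\le 2^\lambda$. **Protocol functions** of a local copy $\mathcal D$ ($\bot$ = not yet available). For a unit $U_0$ of round $r$: $\mathrm{CommonVote}(U_0,r')$ is $1$ if $r'\le r+3$, $0$ if $r'=r+4$, and the first bit of $\mathrm{hash}(x_{r'})$ otherwise ($\bot$ if $x_{r'}$ is not available). $\mathrm{Vote}(U_0,U)$ is $[U_0<U]$ if $U$ has round $\le r+1$; otherwise it is the common vote on $U_0$ of the units in $\downarrow U$ if they are unanimous, and $\mathrm{CommonVote}(U_0,\mathrm{round}(U))$ if not. $U$ decides $v$ on $U_0$ if $\mathrm{round}(U)\ge r+2$, $v=\mathrm{CommonVote}(U_0,\mathrm{round}(U))$ and at least $2f+1$ units of $\downarrow U$ vote $v$ on $U_0$; $\mathrm{Decide}(U_0,\mathcal D)=v$ if some $U\in\mathcal D$ decides $v$ on $U_0$, and $\bot$ if there is none. $\mathrm{ChooseHead}(r,\mathcal D)$ sorts the units of round $r$ in $\mathcal D$ by the priorities $\mathrm{hash}(x_{r+4}\|U)$ (ties by creator) and returns the first unit that is decided $1$, provided all units before it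 are decided $0$; otherwise, or if $x_{r+4}$ is not available, it returns $\bot$. $\mathrm{OrderUnits}(\mathcal D)$ goes through $r=0,1,\dots$ up to the height of $\mathcal D$, stops at the first $r$ with $\mathrm{ChooseHead}(r,\mathcal D)=\bot$, and otherwise appends to its list, in a deterministic topological order, all units $U\le \mathrm{ChooseHead}(r,\mathcal D)$ of $\mathcal D$ that are not yet in the list. **Theorem.** Let $W_r\in\mathbb N\cup\{\infty\}$ be the smallest $l$ such that for every local copy $\mathcal D$ of height $r+l$ held by an honest node at any time, $\mathrm{ChooseHead}(r,\mathcal D)\ne\bot$ and $\mathrm{ChooseHead}(r,\mathcal D)\in \mathrm{OrderUnits}(\mathcal D)$. Then $W_r$ is a random variable, and there is an absolute constant $C$ (independent of $f$, $\lambda$, the set of honest nodes, the adversary and $r$) such that $$P(W_r\ge K)\le C\,K\,2^{-K}\quad(K=1,2,\dots),\qquad \mathbb E(W_r)\le C .$$ -/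

import Mathlib

open MeasureTheory
open scoped NNReal ENNReal

namespace Aleph

/-! ### Units -/

/-- The `N = 3 f + 1` nodes. -/
abbrev Node (f : ℕ) : Type := Fin (3 * f + 1)

/-- A unit consists of its creator, some data (an arbitrary bit string) and a list of `k` parents.
Parents are referenced by collision-free hashes in the protocol, so a unit determines its parents;
here they are simply subterms. -/
inductive BUnit (f : ℕ) : Type where
  | mk (creator : Node f) (data : List Bool) (k : ℕ) (parent : Fin k → BUnit f) : BUnit f

namespace BUnit

variable {f : ℕ}

/-- The creator of a unit. -/
def creator : BUnit f → Node f
  | mk c _ _ _ => c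

open Classical in
/-- The set of parents of a unit. -/
noncomputable def parents : BUnit f → Finset (BUnit f)
  | mk _ _ _ p => Finset.univ.image p

/-- The DAG-round of a unit: `0` without parents, otherwise one more than the maximal DAG-round
of a parent. -/
def round : BUnit f → ℕ
  | mk _ _ _ p => Finset.univ.sup fun i => (p i).round + 1

/-- `U₀ < U`: the unit `U₀` is reached from `U` by following parent pointers at least once. -/
def Below (U₀ U : BUnit f) : Prop :=
  Relation.TransGen (fun V W : BUnit f => V ∈ W.parents) U₀ U

/-- `U₀ ≤ U`. -/
def BelowEq (U₀ U : BUnit f) : Prop :=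
  U₀ = U ∨ Below U₀ U

/-- `↓U`: the parents of `U` whose DAG-round is that of `U` minus one. -/
noncomputable def down (U : BUnit f) : Finset (BUnit f) :=
  U.parents.filter fun V => V.round + 1 = U.round

/-- The validity rules that a single unit has to obey: Diversity (its parents have pairwise distinct
creators) and Dissemination (a unit of round `r > 0` has at least `2 f + 1` parents of round
`r - 1`). -/
def Valid (U : BUnit f) : Prop :=
  Set.InjOn creator (U.parents : Set (BUnit f)) ∧ (U.round = 0 ∨ 2 * f + 1 ≤ U.down.card)

end BUnit

/-- The height of a local copy: the maximal DAG-round of a unit in it. -/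
def height {f : ℕ} (D : Finset (BUnit f)) : ℕ := D.sup BUnit.round

/-! ### Common randomness

The secret `x_r` of round `r` enters the protocol only through the values `hash (x_r)` and
`hash (x_r ‖ U)` of the random oracle, and is therefore represented by its name `r`. -/

/-- An input of the random oracle: `(r, none)` stands for `x_r` and `(r, some U)` for `x_r ‖ U`. -/
abbrev Query (f : ℕ) : Type := ℕ × Option (BUnit f)

/-- Outputs of the random oracle: bit strings of length `lam`, read as binary numbers. -/
abbrev Hash (lam : ℕ) : Type := Fin (2 ^ lam)

/-- The first (most significant) bit of a bit string of length `lam`. -/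
def Hash.firstBit {lam : ℕ} (h : Hash lam) : Bool := h.val.testBit (lam - 1)

/-- A random oracle. -/
abbrev Oracle (f lam : ℕ) : Type := Query f → Hash lam

/-- The law of the random oracle: its values are independent and uniform. -/
noncomputable def oracleLaw (f lam : ℕ) : Measure (Oracle f lam) :=
  Measure.infinitePi fun _ : Query f => (PMF.uniformOfFintype (Hash lam)).toMeasure

section Protocol

variable {f lam : ℕ} (H : Oracle f lam) (D : Finset (BUnit f))

open Classical in
/-- `SecretBits(·, r, D)`: the (name of the) secret of round `r`; it can be extracted from a local
copy as soon as this contains a unit of round `r + 1`. -/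
noncomputable def secretBits (r : ℕ) : Option ℕ :=
  if ∃ U ∈ D, U.round = r + 1 then some r else none

/-- `CommonVote(U₀, r, D)`; `none` stands for `⊥`. -/
noncomputable def commonVote (U₀ : BUnit f) (r : ℕ) : Option Bool :=
  if r ≤ U₀.round + 3 then some true
  else if r = U₀.round + 4 then some false
  else (secretBits D r).map fun x => (H (x, none)).firstBit

/-! ### Virtual voting -/

open Classical in
/-- `Vote(U₀, U, D)`, where `A` is the set of the votes of the units in `↓U`. -/
noncomputable def vote (U₀ : BUnit f) : BUnit f → Option Bool
  | .mk c d k p =>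
    if (BUnit.mk c d k p).round ≤ U₀.round + 1 then
      some (decide (BUnit.Below U₀ (.mk c d k p)))
    else
      let A : Set (Option Bool) :=
        {v | ∃ i, (p i).round + 1 = (BUnit.mk c d k p).round ∧ vote U₀ (p i) = v}
      if A = {some true} then some true
      else if A = {some false} then some false
      else commonVote H D U₀ (BUnit.mk c d k p).round

/-- `UnitDecide(U₀, U, D)`. -/
noncomputable def unitDecide (U₀ U : BUnit f) : Option Bool :=
  if U.round < U₀.round + 2 then none
  else
    match commonVote H D U₀ U.round with
    | none => none
    | some v => if 2 * f + 1 ≤ (U.down.filter fun V => vote H D U₀ V = some v).card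
        then some v else none

open Classical in
/-- `Decide(U₀, D)`. -/
noncomputable def decideUnit (U₀ : BUnit f) : Option Bool :=
  if ∃ U ∈ D, unitDecide H D U₀ U = some true then some true
  else if ∃ U ∈ D, unitDecide H D U₀ U = some false then some false
  else none

/-! ### Choosing heads and ordering units -/

/-- The units of round `r` in `D`, sorted by their priorities `hash (x ‖ U)`, where `x` is the secret
of round `r + 4`; equal priorities are ordered by creator. -/
noncomputable def sortedByPriority (r x : ℕ) : List (BUnit f) :=
  (D.filter fun U => U.round = r).toList.mergeSort fun U V =>
    decide (H (x, some U) < H (x, some V) ∨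
      H (x, some U) = H (x, some V) ∧ U.creator ≤ V.creator)

/-- `GeneratePermutation(r, D)`. -/
noncomputable def generatePermutation (r : ℕ) : Option (List (BUnit f)) :=
  (secretBits D (r + 4)).map fun x => sortedByPriority H D r x

/-- The loop of `ChooseHead`: the first unit of the list that is decided `1`, provided that all units
before it are decided `0`. -/
noncomputable def firstPositive : List (BUnit f) → Option (BUnit f)
  | [] => none
  | U :: L =>
    match decideUnit H D U with
    | some true => some U
    | some false => firstPositive L
    | none => none

/-- `ChooseHead(r, D)`. -/
noncomputable def chooseHead (r : ℕ) : Option (BUnit f) :=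
  (generatePermutation H D r).bind fun L => firstPositive H D L

open Classical in
/-- The batch of units that the head `V` adds to the list `linord`, in a deterministic topological
order: by round, units of the same round by creator. -/
noncomputable def batch (V : BUnit f) (linord : List (BUnit f)) : List (BUnit f) :=
  (D.filter fun U => U.BelowEq V ∧ U ∉ linord).toList.mergeSort fun U W =>
    decide (U.round < W.round ∨ U.round = W.round ∧ U.creator ≤ W.creator)

/-- The loop of `OrderUnits`: `n` iterations, starting from round `r` with the list `linord`. -/
noncomputable def orderLoop : (n r : ℕ) → (linord : List (BUnit f)) → List (BUnit f)
  | 0, _, linord => linord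
  | n + 1, r, linord =>
    match chooseHead H D r with
    | none => linord
    | some V => orderLoop n (r + 1) (linord ++ batch D V linord)

/-- `OrderUnits(D)`. -/
noncomputable def orderUnits : List (BUnit f) :=
  orderLoop H D (height D + 1) 0 []

end Protocol

/-! ### Executions

The adversary schedules everything: in each step it lets some node create and reliably broadcast a
unit, or lets the reliable broadcast deliver a unit to a node, or asks the random oracle about a
secret that it can already know. -/

/-- A step of the execution. -/
inductive Action (f : ℕ) : Type where
  /-- The creator of `U` creates and broadcasts `U`. -/
  | create (U : BUnit f)
  /-- The unit `U` is added to the local copy of node `i`. -/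
  | deliver (i : Node f) (U : BUnit f)
  /-- The adversary asks for a value of the random oracle. -/
  | ask (q : Query f)

/-- The state of an execution, which is also the view of the adversary. -/
structure Config (f lam : ℕ) : Type where
  /-- the units broadcast so far -/
  units : Finset (BUnit f)
  /-- the local copies of the nodes -/
  copy : Node f → Finset (BUnit f)
  /-- the steps so far, latest first, with the answers of the random oracle -/
  log : List (Action f × Option (Hash lam))

/-- An adversary chooses the next step from everything that has happened so far. -/
abbrev Adversary (f lam : ℕ) : Type := Config f lam → Action f

/-- `CreateUnit`, run by an honest node with local copy `D`: having created units of rounds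
`0, …, r - 1`, the node waits until `D` contains at least `2 f + 1` units of round `r - 1` (if
`r > 0`), and then creates a unit of round `r` whose parents are, for each node, the unit of maximal
round `< r` by that node in `D`. -/
def HonestRule {f : ℕ} (D : Finset (BUnit f)) (U : BUnit f) : Prop :=
  (D.filter fun V => V.creator = U.creator).card = U.round ∧
  (U.round = 0 ∨ 2 * f + 1 ≤ (D.filter fun V => V.round + 1 = U.round).card) ∧
  ∀ V, V ∈ U.parents ↔ V ∈ D ∧ V.round < U.round ∧
    ∀ V' ∈ D, V'.creator = V.creator → V'.round < U.round → V'.round ≤ V.round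

section Execution

variable {f lam : ℕ} (honest : Finset (Node f))

/-- The unit `U` may be created: it is valid, its parents exist, its creator has not broadcast a unit
of the same round before (reliable broadcast excludes forks), and if the creator is honest, then it
follows `CreateUnit`. Dishonest nodes are not restricted further. -/
def CanCreate (c : Config f lam) (U : BUnit f) : Prop :=
  U.Valid ∧ U.parents ⊆ c.units ∧
  (∀ V ∈ c.units, V.creator = U.creator → V.round ≠ U.round) ∧
  (U.creator ∈ honest → HonestRule (c.copy U.creator) U)

/-- The unit `U` may be added to the local copy of `i`: it has been broadcast, and its parents are
already in this local copy. -/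
def CanDeliver (c : Config f lam) (i : Node f) (U : BUnit f) : Prop :=
  U ∈ c.units ∧ U.parents ⊆ c.copy i

/-- The secret of round `r` is available to the adversary: some honest node has created a unit of
round `r`. Before that, the random oracle cannot be evaluated at this secret. -/
def Revealed (c : Config f lam) (r : ℕ) : Prop :=
  ∃ U ∈ c.units, U.creator ∈ honest ∧ U.round = r

open Classical in
/-- The effect of a step; forbidden steps do nothing (but are recorded). -/
noncomputable def step (H : Oracle f lam) (c : Config f lam) : Action f → Config f lam
  | .create U =>
    if CanCreate honest c U then
      { units := insert U c.units
        copy := Function.update c.copy U.creator (insert U (c.copy U.creator))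
        log := (.create U, none) :: c.log }
    else { c with log := (.create U, none) :: c.log }
  | .deliver i U =>
    if CanDeliver c i U then
      { c with
        copy := Function.update c.copy i (insert U (c.copy i))
        log := (.deliver i U, none) :: c.log }
    else { c with log := (.deliver i U, none) :: c.log }
  | .ask q =>
    { c with log := (.ask q, if Revealed honest c q.1 then some (H q) else none) :: c.log }

/-- The state after `t` steps. -/
noncomputable def run (adv : Adversary f lam) (H : Oracle f lam) : ℕ → Config f lam
  | 0 => { units := ∅, copy := fun _ => ∅, log := [] }
  | t + 1 => step honest H (run adv H t) (adv (run adv H t))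

/-- The head of round `r` is chosen and appended to the linear order in the local copy `D`:
`ChooseHead(r, D) ∈ OrderUnits(D)`. -/
def HeadOrdered (H : Oracle f lam) (r : ℕ) (D : Finset (BUnit f)) : Prop :=
  ∃ V, chooseHead H D r = some V ∧ V ∈ orderUnits H D

/-- `W_r`: the smallest `l` such that in every local copy of height `r + l` that an honest node holds
at any time of the execution, the head of round `r` is appended to the linear order (`⊤` if there is
no such `l`). -/
noncomputable def headLatency (adv : Adversary f lam) (r : ℕ) (H : Oracle f lam) : ℕ∞ :=
  sInf {w : ℕ∞ | ∃ l : ℕ, w = l ∧ ∀ t : ℕ, ∀ i ∈ honest,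
    height ((run honest adv H t).copy i) = r + l → HeadOrdered H r ((run honest adv H t).copy i)}

end Execution

end Aleph

/-!
The head of a round `r` is missing in a local copy only if some undecided unit `U` of round `r`
precedes, in the order of the priorities, every unit that is decided `1`. The proof bounds the
probability of this event in a copy of height `r + k` by `O(k 2⁻ᵏ)`.

*Popular units.* When the first honest unit of round at least `r + 4` is created, the priorities
of round `r` are still independent of everything that has happened. By then at least `f + 1` units
of round `r` are *popular*, i.e. below `f + 1` units of round `r + 1` (`exists_popular`, a double
count), and these are decided `1` in every high copy (`Popular.decideUnit_eq`). By symmetry a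
given early unit that is not popular precedes all popular ones with probability at most
`1 / (f + 2) + 2 ^ (-lam)`, the second term coming from ties (`measure_precedes_le`). Hence at most four
early units precede all popular ones on average; this uses `3 f + 1 ≤ 2 ^ lam`.

*Early units.* Fix an early unit `U` and a round `s ≥ r + 5`. When the first honest unit of round
at least `s` is created, the coin of round `s` is still unknown, and `2 f + 1` units of round
`s - 1` exist; `guess` is a majority vote of them. If the coin agrees with the guess, then all units of
round `s` vote alike, because no unit can see a unanimous opposite vote (`aligned_of_quorum`).
From then on all votes and all guesses on `U` agree, so that a second right guess decides `U`
(`atMostOneHit_of_decideUnit`). The guesses are made before the coins are tossed, whence `m` of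
them are right at most once with probability at most `(m + 1) 2⁻ᵐ` (`measure_atMostOneHit_le`),
even conditionally on the priorities.

*Late units.* A dishonest node may create its unit of round `r` after it has learnt the
priorities, and choose its data so as to get a high priority. But such a unit gets the vote `0` of
all units of round `r + 4`, and the first coin `0` decides all late units at once
(`coin_eq_true_of_late`).

Adaptivity of the adversary is handled by the sets `early s`: they are determined by the oracle
values at secrets of rounds `< s` (`early_congr`), so that the remaining oracle values may be
permuted without changing them. Finally, the head of round `r` is ordered as soon as the heads of
all rounds `r - j` are chosen; summing the bounds for the heights `(r - j) + (j + l)` gives the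
tail of the latency, and summing the tail gives its expectation.
-/

namespace Aleph

open scoped Classical

variable {f lam : ℕ}

/-! ### The law of the random oracle -/

/-- Units are finitely branching trees with countably many labels. -/
instance countable_bUnit (f : ℕ) : Countable (BUnit f) := by
  let β : Node f × List Bool × ℕ → Type := fun a => Fin a.2.2
  let toW : BUnit f → WType β := fun U =>
    BUnit.rec (motive := fun _ => WType β) (fun c d k _ ih => WType.mk (c, d, k) ih) U
  have inj : Function.Injective toW := by
    intro U
    induction U with
    | mk c d k p ih =>
      intro V h
      cases V with
      | mk c' d' k' p' =>
        have h' : WType.mk (β := β) (c, d, k) (fun i => toW (p i)) =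
          WType.mk (β := β) (c', d', k') (fun i => toW (p' i)) := h
        simp only [WType.mk.injEq, Prod.mk.injEq] at h'
        obtain ⟨⟨rfl, rfl, rfl⟩, h2⟩ := h'
        congr 1
        funext i
        exact ih i (congrFun (eq_of_heq h2) i)
  exact inj.countable

instance isProbabilityMeasure_oracleLaw (f lam : ℕ) : IsProbabilityMeasure (oracleLaw f lam) := by
  unfold oracleLaw; infer_instance

/-- Permuting the possible values of one query preserves the law of the oracle. -/
lemma measurePreserving_update (q : Query f) (σ : Equiv.Perm (Hash lam)) :
    MeasurePreserving (fun H : Oracle f lam => Function.update H q (σ (H q)))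
      (oracleLaw f lam) (oracleLaw f lam) := by
  have hfun : (fun H : Oracle f lam => Function.update H q (σ (H q))) =
      fun H i => (if i = q then (σ : Hash lam → Hash lam) else id) (H i) := by
    funext H i
    by_cases h : i = q
    · subst h; simp
    · simp [h]
  have hunif : (PMF.uniformOfFintype (Hash lam)).toMeasure.map σ =
      (PMF.uniformOfFintype (Hash lam)).toMeasure := by
    refine Measure.ext_of_singleton fun a => ?_
    rw [Measure.map_apply (measurable_of_finite _) (measurableSet_singleton a)]
    have : (σ : Hash lam → Hash lam) ⁻¹' {a} = {σ.symm a} := by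
      ext x; simp [Equiv.eq_symm_apply]
    rw [this, PMF.toMeasure_apply_singleton _ _ (measurableSet_singleton _),
      PMF.toMeasure_apply_singleton _ _ (measurableSet_singleton _)]
    simp
  refine ⟨?_, ?_⟩
  · rw [hfun]
    exact measurable_pi_lambda _ fun i => (measurable_of_finite _).comp (measurable_pi_apply i)
  · rw [hfun]
    unfold oracleLaw
    rw [Measure.infinitePi_map_pi
      (f := fun i => (if i = q then (σ : Hash lam → Hash lam) else id)) _
      (fun i => measurable_of_finite _)]
    congr 1
    funext i
    split_ifs with h
    · exact hunif
    · exact Measure.map_id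

/-- Exchanging the answers to two queries preserves the law of the oracle. -/
lemma measurePreserving_swap (q q' : Query f) :
    MeasurePreserving (fun (H : Oracle f lam) i => H (Equiv.swap q q' i))
      (oracleLaw f lam) (oracleLaw f lam) := by
  refine ⟨measurable_pi_lambda _ fun i => measurable_pi_apply _, ?_⟩
  have h := Measure.infinitePi_map_piCongrLeft (ι := Query f) (X := fun _ => Hash lam)
    (fun _ => (PMF.uniformOfFintype (Hash lam)).toMeasure) (Equiv.swap q q')
  unfold oracleLaw
  convert h using 2
  funext H i
  have := Equiv.piCongrLeft_apply_apply (fun _ => Hash lam) (Equiv.swap q q') H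
    (Equiv.swap q q' i)
  rw [Equiv.swap_apply_self] at this
  exact this.symm

/-- An event that depends on finitely many oracle values is measurable. -/
lemma measurableSet_of_finset (S : Finset (Query f)) (P : Oracle f lam → Prop)
    (h : ∀ H H' : Oracle f lam, (∀ q ∈ S, H q = H' q) → P H → P H') :
    MeasurableSet {H | P H} := by
  have : {H | P H} = S.restrict ⁻¹' (S.restrict '' {H : Oracle f lam | P H}) := by
    ext H
    constructor
    · exact fun hH => ⟨H, hH, rfl⟩
    · rintro ⟨H', hH', e⟩
      exact h H' H (fun q hq => congrFun e ⟨q, hq⟩) hH'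
  rw [this]
  exact (Finset.measurable_restrict S) (Set.toFinite _).measurableSet

/-! ### Guessing oracle values -/

/-- Two oracles agree on all queries at secrets of rounds `< s`. -/
def AgreeBelow (s : ℕ) (H H' : Oracle f lam) : Prop := ∀ q : Query f, q.1 < s → H q = H' q

/-- The event `A` is determined by the oracle values at secrets of rounds `< s`. -/
def DeterminedBelow (s : ℕ) (A : Set (Oracle f lam)) : Prop :=
  ∀ ⦃H H' : Oracle f lam⦄, AgreeBelow s H H' → (H ∈ A ↔ H' ∈ A)

lemma AgreeBelow.symm {s : ℕ} {H H' : Oracle f lam} (h : AgreeBelow s H H') :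
    AgreeBelow s H' H := fun q hq => (h q hq).symm

lemma AgreeBelow.mono {s t : ℕ} {H H' : Oracle f lam} (h : AgreeBelow t H H') (hst : s ≤ t) :
    AgreeBelow s H H' := fun q hq => h q (hq.trans_le hst)

lemma DeterminedBelow.mono {s t : ℕ} {A : Set (Oracle f lam)} (h : DeterminedBelow s A)
    (hst : s ≤ t) : DeterminedBelow t A := fun _ _ hH => h (hH.mono hst)

lemma DeterminedBelow.inter {s : ℕ} {A B : Set (Oracle f lam)} (hA : DeterminedBelow s A)
    (hB : DeterminedBelow s B) : DeterminedBelow s (A ∩ B) :=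
  fun _ _ hH => and_congr (hA hH) (hB hH)

lemma agreeBelow_update (q : Query f) (x : Hash lam) (H : Oracle f lam) :
    AgreeBelow q.1 H (Function.update H q x) := by
  intro q' hq'
  rw [Function.update_of_ne]
  rintro rfl
  exact lt_irrefl _ hq'

/-- The coin of round `s`: the first bit of the hash of the secret of round `s`. -/
def coin (s : ℕ) (H : Oracle f lam) : Bool := (H (s, none)).firstBit

/-- Inverting the first bit is a permutation of the nonempty bit strings. -/
lemma exists_flip (hlam : 0 < lam) :
    ∃ σ : Equiv.Perm (Hash lam), ∀ x, (σ x).firstBit = !x.firstBit := by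
  have hlt : ∀ x : Hash lam, x.val ^^^ 2 ^ (lam - 1) < 2 ^ lam := fun x =>
    Nat.xor_lt_two_pow x.2 (Nat.pow_lt_pow_right (by norm_num) (by omega))
  let g : Hash lam → Hash lam := fun x => ⟨x.val ^^^ 2 ^ (lam - 1), hlt x⟩
  have hg : Function.Involutive g := fun x => by
    apply Fin.ext
    simp [g]
  refine ⟨hg.toPerm, fun x => ?_⟩
  change Nat.testBit (x.val ^^^ 2 ^ (lam - 1)) (lam - 1) = !Nat.testBit x.val (lam - 1)
  rw [Nat.testBit_xor, Nat.testBit_two_pow_self, Bool.xor_true]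

lemma measurableSet_coin_eq (s : ℕ) {g : Oracle f lam → Bool}
    (hg : MeasurableSet {H | g H = true}) : MeasurableSet {H | coin s H = g H} := by
  have h1 : MeasurableSet {H : Oracle f lam | coin s H = true} :=
    measurableSet_of_finset {(s, none)} _ fun H H' h hH => by
      simpa [coin, ← h (s, none) (by simp)] using hH
  have : {H | coin s H = g H} = {H | coin s H = true ↔ g H = true} := by
    ext H; simp only [Set.mem_ofPred_eq]; cases coin s H <;> cases g H <;> simp
  rw [this]
  exact h1.iff hg

/-- A guess of the coin of round `s` that is based on the secrets of rounds `< s` is right with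
conditional probability one half. -/
lemma measure_inter_coin (hlam : 0 < lam) (s : ℕ) {A : Set (Oracle f lam)} (hA : MeasurableSet A)
    (dA : DeterminedBelow s A) {g : Oracle f lam → Bool} (hg : MeasurableSet {H | g H = true})
    (dg : DeterminedBelow s {H | g H = true}) :
    oracleLaw f lam (A ∩ {H | coin s H = g H}) = oracleLaw f lam A / 2 ∧
    oracleLaw f lam (A ∩ {H | coin s H ≠ g H}) = oracleLaw f lam A / 2 := by
  obtain ⟨σ, hσ⟩ := exists_flip hlam
  have hm := measurableSet_coin_eq s hg
  have h1 := (measurePreserving_update (lam := lam) ((s, none) : Query f) σ).measure_preimage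
    (hA.inter hm).nullMeasurableSet
  have h2 : (fun H : Oracle f lam => Function.update H (s, none) (σ (H (s, none)))) ⁻¹'
      (A ∩ {H | coin s H = g H}) = A ∩ {H | coin s H ≠ g H} := by
    ext H
    have hag := agreeBelow_update ((s, none) : Query f) (σ (H (s, none))) H
    have e1 := dA hag
    have e2 := dg hag
    have e3 : coin s (Function.update H (s, none) (σ (H (s, none)))) = !coin s H := by
      simp [coin, hσ]
    simp only [Set.mem_preimage, Set.mem_inter_iff, Set.mem_ofPred_eq] at *
    rw [← e1, e3]
    refine and_congr_right fun _ => ?_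
    cases h : g H <;> cases h' : g (Function.update H (s, none) (σ (H (s, none)))) <;>
      cases coin s H <;> simp_all
  rw [h2] at h1
  have h3 := measure_inter_add_sdiff (μ := oracleLaw f lam) A hm
  have h4 : A \ {H | coin s H = g H} = A ∩ {H | coin s H ≠ g H} := by ext; simp
  rw [h4, h1, ← two_mul] at h3
  have h5 : oracleLaw f lam (A ∩ {H | coin s H = g H}) = oracleLaw f lam A / 2 := by
    rw [← h3, mul_comm, ENNReal.mul_div_cancel_right (by simp) (by simp)]
  exact ⟨h5, h1.trans h5⟩

lemma determinedBelow_coin_eq (s : ℕ) {g : Oracle f lam → Bool}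
    (dg : DeterminedBelow s {H | g H = true}) :
    DeterminedBelow (s + 1) {H | coin s H = g H} := by
  intro H H' h
  have e1 : coin s H = coin s H' := by simp [coin, h (s, none) (Nat.lt_succ_self s)]
  have e2 := dg (h.mono (Nat.le_succ s))
  simp only [Set.mem_ofPred_eq] at *
  rw [e1]
  cases hh : g H <;> cases hh' : g H' <;> simp_all

/-- The guesses `g s` of the coins of the rounds `s`, `a ≤ s < a + m`, are right at most once. -/
def AtMostOneHit (g : ℕ → Oracle f lam → Bool) (a m : ℕ) (H : Oracle f lam) : Prop :=
  ∀ s s', a ≤ s → s < s' → s' < a + m → coin s H = g s H → coin s' H ≠ g s' H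

/-- Sequential guesses of `m` fair coins all fail with conditional probability at most `2⁻ᵐ`. -/
lemma measure_noHit_le (hlam : 0 < lam) (a : ℕ) {A : Set (Oracle f lam)} (hA : MeasurableSet A)
    (dA : DeterminedBelow a A) {g : ℕ → Oracle f lam → Bool}
    (hg : ∀ s, a ≤ s → MeasurableSet {H | g s H = true})
    (dg : ∀ s, a ≤ s → DeterminedBelow s {H | g s H = true}) (m : ℕ) :
    MeasurableSet (A ∩ {H | ∀ s, a ≤ s → s < a + m → coin s H ≠ g s H}) ∧
    DeterminedBelow (a + m) (A ∩ {H | ∀ s, a ≤ s → s < a + m → coin s H ≠ g s H}) ∧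
    oracleLaw f lam (A ∩ {H | ∀ s, a ≤ s → s < a + m → coin s H ≠ g s H}) ≤
      oracleLaw f lam A * (2 ^ m)⁻¹ := by
  induction m with
  | zero =>
    have : A ∩ {H | ∀ s, a ≤ s → s < a + 0 → coin s H ≠ g s H} = A := by
      ext H; simp only [Set.mem_inter_iff, Set.mem_ofPred_eq, and_iff_left_iff_imp]
      intro _ s h1 h2; omega
    rw [this]; exact ⟨hA, dA, by simp⟩
  | succ m ih =>
    obtain ⟨i1, i2, i3⟩ := ih
    have : A ∩ {H | ∀ s, a ≤ s → s < a + (m + 1) → coin s H ≠ g s H} =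
        (A ∩ {H | ∀ s, a ≤ s → s < a + m → coin s H ≠ g s H}) ∩
          {H | coin (a + m) H ≠ g (a + m) H} := by
      ext H
      simp only [Set.mem_inter_iff, Set.mem_ofPred_eq, and_assoc, and_congr_right_iff]
      intro _
      constructor
      · exact fun h => ⟨fun s h1 h2 => h s h1 (by omega), h _ (by omega) (by omega)⟩
      · rintro ⟨h1, h2⟩ s h3 h4
        rcases Nat.lt_or_ge s (a + m) with h | h
        · exact h1 s h3 h
        · obtain rfl : s = a + m := by omega
          exact h2
    rw [this]
    have hga := hg (a + m) (by omega)
    have dga := dg (a + m) (by omega)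
    refine ⟨i1.inter (measurableSet_coin_eq _ hga).compl,
      (i2.mono (by omega)).inter fun H H' h => not_congr (determinedBelow_coin_eq _ dga h), ?_⟩
    rw [(measure_inter_coin hlam (a + m) i1 i2 hga dga).2, pow_succ,
      ENNReal.mul_inv (by simp) (by simp), ← mul_assoc, ← div_eq_mul_inv (_ * _) (2 : ℝ≥0∞)]
    gcongr

/-- Sequential guesses of `m` fair coins are right at most once with conditional probability at most
`(m + 1) 2⁻ᵐ`. -/
lemma measure_atMostOneHit_le (hlam : 0 < lam) (a : ℕ) {A : Set (Oracle f lam)}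
    (hA : MeasurableSet A) (dA : DeterminedBelow a A) {g : ℕ → Oracle f lam → Bool}
    (hg : ∀ s, a ≤ s → MeasurableSet {H | g s H = true})
    (dg : ∀ s, a ≤ s → DeterminedBelow s {H | g s H = true}) (m : ℕ) :
    MeasurableSet (A ∩ {H | AtMostOneHit g a m H}) ∧
    DeterminedBelow (a + m) (A ∩ {H | AtMostOneHit g a m H}) ∧
    oracleLaw f lam (A ∩ {H | AtMostOneHit g a m H}) ≤
      oracleLaw f lam A * ((m + 1) * (2 ^ m)⁻¹) := by
  induction m with
  | zero =>
    have : A ∩ {H | AtMostOneHit g a 0 H} = A := by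
      ext H; simp only [Set.mem_inter_iff, Set.mem_ofPred_eq, and_iff_left_iff_imp]
      intro _ s s' h1 h2; omega
    rw [this]; exact ⟨hA, dA, by simp⟩
  | succ m ih =>
    obtain ⟨i1, i2, i3⟩ := ih
    obtain ⟨j1, j2, j3⟩ := measure_noHit_le hlam a hA dA hg dg m
    set Z := A ∩ {H | ∀ s, a ≤ s → s < a + m → coin s H ≠ g s H} with hZ
    set T := A ∩ {H | AtMostOneHit g a m H} with hT
    have : A ∩ {H | AtMostOneHit g a (m + 1) H} =
        (T ∩ {H | coin (a + m) H ≠ g (a + m) H}) ∪ (Z ∩ {H | coin (a + m) H = g (a + m) H}) := by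
      ext H
      simp only [hZ, hT, Set.mem_inter_iff, Set.mem_ofPred_eq, Set.mem_union, and_assoc,
        ← and_or_left,
        and_congr_right_iff]
      intro _
      constructor
      · intro h
        by_cases hh : coin (a + m) H = g (a + m) H
        · exact .inr ⟨fun s h1 h2 h3 => h s (a + m) h1 h2 (by omega) h3 hh, hh⟩
        · exact .inl ⟨fun s s' h1 h2 h3 => h s s' h1 h2 (by omega), hh⟩
      · rintro (⟨h1, h2⟩ | ⟨h1, h2⟩) s s' h3 h4 h5
        · rcases Nat.lt_or_ge s' (a + m) with h | h
          · exact h1 s s' h3 h4 h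
          · obtain rfl : s' = a + m := by omega
            exact fun _ => h2
        · exact fun h => absurd h (h1 s h3 (by omega))
    rw [this]
    have hga := hg (a + m) (by omega)
    have dga := dg (a + m) (by omega)
    have dc := determinedBelow_coin_eq _ dga
    refine ⟨(i1.inter (measurableSet_coin_eq _ hga).compl).union
      (j1.inter (measurableSet_coin_eq _ hga)), fun H H' h => or_congr
        ((i2.mono (by omega)).inter (fun H H' h => not_congr (dc h)) h)
        ((j2.mono (by omega)).inter dc h), ?_⟩
    refine (measure_union_le _ _).trans ?_
    rw [(measure_inter_coin hlam (a + m) i1 i2 hga dga).2,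
      (measure_inter_coin hlam (a + m) j1 j2 hga dga).1]
    calc oracleLaw f lam T / 2 + oracleLaw f lam Z / 2
        ≤ oracleLaw f lam A * ((m + 1) * (2 ^ m)⁻¹) / 2 + oracleLaw f lam A * (2 ^ m)⁻¹ / 2 := by
          gcongr
      _ = oracleLaw f lam A * (((m + 1 : ℕ) + 1) * (2 ^ (m + 1))⁻¹) := by
          rw [pow_succ, ENNReal.mul_inv (by simp) (by simp), div_eq_mul_inv, div_eq_mul_inv]
          push_cast
          ring

/-- By symmetry, `U` is strictly before all units of `p` with probability at most
`1 / (p.card + 1)`, and it ties with the first of them with probability at most `2 ^ (-lam)`. -/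
lemma measure_precedes_le (n : ℕ) {A : Set (Oracle f lam)} (hA : MeasurableSet A)
    (dA : DeterminedBelow n A) (p : Finset (BUnit f)) {U : BUnit f} (hU : U ∉ p) :
    oracleLaw f lam (A ∩ {H | ∀ V ∈ p, H (n, some U) ≤ H (n, some V)}) ≤
      oracleLaw f lam A * ((p.card + 1 : ℝ≥0∞)⁻¹ + (2 ^ lam : ℝ≥0∞)⁻¹) := by
  set μ := oracleLaw f lam
  -- Each of `c` disjoint events inside `A` of equal probability has probability at most `μ A / c`.
  have key : ∀ {ι : Type} (J : Finset ι) (M : ι → Set (Oracle f lam)) (m : ℝ≥0∞) (c : ℝ≥0∞),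
      (∀ j ∈ J, MeasurableSet (M j)) → (∀ j ∈ J, M j ⊆ A) → (∀ j ∈ J, μ (M j) = m) →
      (∀ j ∈ J, ∀ j' ∈ J, j ≠ j' → Disjoint (M j) (M j')) → (J.card : ℝ≥0∞) = c →
      c ≠ 0 → m ≤ μ A * c⁻¹ := by
    intro ι J M m c hM hMA hm hdis hc hc0
    have h1 : ∑ j ∈ J, μ (M j) ≤ μ A := by
      rw [← measure_biUnion_finset (fun j hj j' hj' h => hdis j hj j' hj' h) hM]
      exact measure_mono (Set.iUnion₂_subset hMA)
    rw [Finset.sum_congr rfl hm, Finset.sum_const, nsmul_eq_mul, hc] at h1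
    rw [← div_eq_mul_inv, ENNReal.le_div_iff_mul_le (.inl hc0)
      (.inl (by rw [← hc]; exact ENNReal.natCast_ne_top _)), mul_comm]
    exact h1
  have hfin : ∀ (S : Finset (BUnit f)) (P : Oracle f lam → Prop),
      (∀ H H' : Oracle f lam, (∀ V ∈ S, H (n, some V) = H' (n, some V)) → P H → P H') →
      MeasurableSet {H | P H} := fun S P h =>
    measurableSet_of_finset (S.image fun V => (n, some V)) P fun H H' hH =>
      h H H' fun V hV => hH _ (Finset.mem_image_of_mem _ hV)
  -- `M x` says that `x` is strictly first; exchanging priorities shows that all `M x` are equally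
  -- likely.
  let M : BUnit f → Set (Oracle f lam) := fun x =>
    A ∩ {H | ∀ V ∈ insert U p, V ≠ x → H (n, some x) < H (n, some V)}
  have hMm : ∀ x ∈ insert U p, MeasurableSet (M x) := fun x hx =>
    hA.inter (hfin (insert U p) _ fun H H' h hH V hV hVx => by
      rw [← h x hx, ← h V hV]; exact hH V hV hVx)
  have hMU : μ (M U) ≤ μ A * (p.card + 1 : ℝ≥0∞)⁻¹ := by
    have hne : (p.card + 1 : ℝ≥0∞) ≠ 0 := by simp
    have hcard : ((insert U p).card : ℝ≥0∞) = p.card + 1 := by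
      rw [Finset.card_insert_of_notMem hU]; push_cast; rfl
    have : ∀ x ∈ insert U p, μ (M x) = μ (M U) := by
      intro x hx
      rw [← (measurePreserving_swap (lam := lam) ((n, some U) : Query f)
        (n, some x)).measure_preimage (hMm x hx).nullMeasurableSet]
      congr 1
      ext H
      have hag : AgreeBelow n H (fun i => H (Equiv.swap (n, some U) (n, some x) i)) := by
        intro q hq
        change H q = H _
        rw [Equiv.swap_apply_of_ne_of_ne] <;> rintro rfl <;> exact lt_irrefl _ hq
      simp only [M, Set.mem_preimage, Set.mem_inter_iff, Set.mem_ofPred_eq, Equiv.swap_apply_right]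
      rw [← dA hag]
      refine and_congr_right fun _ => ?_
      have hsw : ∀ V, Equiv.swap ((n, some U) : Query f) (n, some x) (n, some V) =
          (n, some (Equiv.swap U x V)) := by
        intro V
        simp only [Equiv.swap_apply_def, Prod.mk.injEq, Option.some.injEq, true_and]
        split_ifs <;> rfl
      simp only [hsw]
      have hmem : ∀ V ∈ insert U p, Equiv.swap U x V ∈ insert U p := by
        intro V hV
        simp only [Equiv.swap_apply_def]
        split_ifs
        · exact hx
        · exact Finset.mem_insert_self _ _
        · exact hV
      constructor
      · intro h V hV hVU
        have := h _ (hmem V hV) (by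
          intro e; apply hVU
          rw [Equiv.swap_apply_eq_iff] at e
          simpa using e)
        simpa using this
      · intro h V hV hVx
        exact h _ (hmem V hV) (by
          intro e; apply hVx
          rw [Equiv.swap_apply_eq_iff] at e
          simpa using e)
    refine key (insert U p) M _ _ hMm (fun _ _ => Set.inter_subset_left) this ?_ hcard hne
    intro x hx y hy hxy
    refine Set.disjoint_left.2 fun H h1 h2 => ?_
    exact lt_asymm (h1.2 y hy hxy.symm) (h2.2 x hx hxy)
  -- `T j` says that the priority of `U` would tie with the smallest one in `p` if it were shifted
  -- cyclically by `j`; all `T j` are equally likely.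
  let T : Hash lam → Set (Oracle f lam) := fun j =>
    A ∩ {H | (∀ V ∈ p, H (n, some U) + j ≤ H (n, some V)) ∧
      ∃ V ∈ p, H (n, some U) + j = H (n, some V)}
  have hTm : ∀ j, MeasurableSet (T j) := fun j =>
    hA.inter (hfin (insert U p) _ fun H H' h hH => by
      have hU' := h U (Finset.mem_insert_self _ _)
      have hV' := fun V hV => h V (Finset.mem_insert_of_mem hV)
      refine ⟨fun V hV => ?_, ?_⟩
      · rw [← hU', ← hV' V hV]; exact hH.1 V hV
      · obtain ⟨V, hV, e⟩ := hH.2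
        exact ⟨V, hV, by rw [← hU', ← hV' V hV]; exact e⟩)
  have hT0 : μ (T 0) ≤ μ A * (2 ^ lam : ℝ≥0∞)⁻¹ := by
    have : ∀ j ∈ (Finset.univ : Finset (Hash lam)), μ (T j) = μ (T 0) := by
      intro j _
      rw [← (measurePreserving_update (lam := lam) ((n, some U) : Query f)
        (Equiv.addRight j)).measure_preimage (hTm 0).nullMeasurableSet]
      congr 1
      ext H
      have hag := agreeBelow_update ((n, some U) : Query f) (Equiv.addRight j (H (n, some U))) H
      have hne : ∀ V ∈ p, ((n, some V) : Query f) ≠ (n, some U) := by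
        intro V hV e
        simp only [Prod.mk.injEq, Option.some.injEq, true_and] at e
        exact hU (e ▸ hV)
      simp only [T, Set.mem_preimage, Set.mem_inter_iff, Set.mem_ofPred_eq]
      rw [← dA hag]
      refine and_congr_right fun _ => ?_
      simp only [Function.update_self, add_zero, Equiv.coe_addRight]
      refine and_congr (forall₂_congr fun V hV => ?_)
        (exists_congr fun V => and_congr_right fun hV => ?_)
      · rw [Function.update_of_ne (hne V hV)]
      · rw [Function.update_of_ne (hne V hV)]
    refine key Finset.univ T _ _ (fun j _ => hTm j) (fun _ _ => Set.inter_subset_left) this ?_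
      (by simp) (by simp)
    intro j _ j' _ hjj
    refine Set.disjoint_left.2 fun H h1 h2 => hjj ?_
    obtain ⟨V, hV, e⟩ := h1.2.2
    obtain ⟨V', hV', e'⟩ := h2.2.2
    have i1 := h1.2.1 V' hV'
    have i2 := h2.2.1 V hV
    rw [← e'] at i1
    rw [← e] at i2
    exact add_left_cancel (le_antisymm i1 i2)
  calc μ (A ∩ {H | ∀ V ∈ p, H (n, some U) ≤ H (n, some V)})
      ≤ μ (M U ∪ T 0) := by
        refine measure_mono fun H hH => ?_
        by_cases hh : ∃ V ∈ p, H (n, some U) = H (n, some V)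
        · exact .inr ⟨hH.1, by simpa using hH.2, by simpa using hh⟩
        · push Not at hh
          refine .inl ⟨hH.1, fun V hV hVU => ?_⟩
          have hV := (Finset.mem_insert.1 hV).resolve_left hVU
          exact lt_of_le_of_ne (hH.2 V hV) (hh V hV)
    _ ≤ μ (M U) + μ (T 0) := measure_union_le _ _
    _ ≤ _ := by rw [mul_add]; gcongr

/-! ### Units and quorums -/

namespace BUnit

lemma mem_parents_mk {c : Node f} {d : List Bool} {k : ℕ} {p : Fin k → BUnit f} {V : BUnit f} :
    V ∈ (mk c d k p).parents ↔ ∃ i, p i = V := by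
  simp [parents]

lemma round_lt_of_mem_parents {U V : BUnit f} (h : V ∈ U.parents) : V.round < U.round := by
  cases U with
  | mk c d k p =>
    obtain ⟨i, rfl⟩ := mem_parents_mk.1 h
    rw [round, ← Nat.succ_le_iff]
    exact Finset.le_sup (f := fun i => (p i).round + 1) (Finset.mem_univ i)

lemma mem_down {U V : BUnit f} : V ∈ U.down ↔ V ∈ U.parents ∧ V.round + 1 = U.round := by
  simp [down]

lemma below_of_mem_parents {U V : BUnit f} (h : V ∈ U.parents) : Below V U := .single h

end BUnit

/-- A set of units that contains all parents of its members, obeys the validity rules and contains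
no forks. -/
structure IsDag (S : Set (BUnit f)) : Prop where
  /-- The parents of a unit belong to the set. -/
  closed : ∀ U ∈ S, ∀ V ∈ U.parents, V ∈ S
  /-- All units are valid. -/
  valid : ∀ U ∈ S, U.Valid
  /-- A creator has at most one unit in each round. -/
  noFork : ∀ U ∈ S, ∀ V ∈ S, U.creator = V.creator → U.round = V.round → U = V

namespace IsDag

variable {S : Set (BUnit f)}

lemma mem_of_below (hS : IsDag S) {U V : BUnit f} (hU : U ∈ S) (h : V.Below U) : V ∈ S := by
  induction h with
  | single h => exact hS.closed _ hU _ h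
  | tail _ h' ih => exact ih (hS.closed _ hU _ h')

lemma mono {S' : Set (BUnit f)} (hS : IsDag S) (hsub : S' ⊆ S)
    (h : ∀ U ∈ S', ∀ V ∈ U.parents, V ∈ S') : IsDag S' :=
  ⟨h, fun U hU => hS.valid U (hsub hU), fun U hU V hV => hS.noFork U (hsub hU) V (hsub hV)⟩

lemma injOn_creator (hS : IsDag S) {Q : Finset (BUnit f)} {y : ℕ}
    (hQ : ∀ V ∈ Q, V ∈ S ∧ V.round = y) : Set.InjOn BUnit.creator (Q : Set (BUnit f)) :=
  fun U hU V hV h => hS.noFork U (hQ U hU).1 V (hQ V hV).1 h ((hQ U hU).2.trans (hQ V hV).2.symm)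

lemma card_le (hS : IsDag S) {Q : Finset (BUnit f)} {y : ℕ}
    (hQ : ∀ V ∈ Q, V ∈ S ∧ V.round = y) : Q.card ≤ 3 * f + 1 := by
  have := Finset.card_le_card_of_injOn (t := (Finset.univ : Finset (Node f))) BUnit.creator
    (fun _ _ => Finset.mem_univ _) (hS.injOn_creator hQ)
  simpa using this

/-- A valid unit `W` with parents in `S` has `2 f + 1` units of every smaller round below it. -/
lemma exists_quorum (hS : IsDag S) {W : BUnit f} (hW : W.Valid) (hp : ∀ V ∈ W.parents, V ∈ S)
    {y : ℕ} (hy : y < W.round) :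
    ∃ Q : Finset (BUnit f), 2 * f + 1 ≤ Q.card ∧ ∀ V ∈ Q, V ∈ S ∧ V.round = y := by
  obtain ⟨n, hn⟩ : ∃ n, W.round = y + 1 + n := ⟨W.round - (y + 1), by omega⟩
  induction n generalizing W with
  | zero =>
    refine ⟨W.down, hW.2.resolve_left (by omega), fun V hV => ?_⟩
    rw [BUnit.mem_down] at hV
    exact ⟨hp V hV.1, by omega⟩
  | succ n ih =>
    obtain ⟨V, hV⟩ : W.down.Nonempty := by
      rw [← Finset.card_pos]; exact (Nat.succ_pos _).trans_le (hW.2.resolve_left (by omega))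
    rw [BUnit.mem_down] at hV
    exact ih (hS.valid V (hp V hV.1)) (hS.closed V (hp V hV.1)) (by omega) (by omega)

lemma exists_round_eq (hS : IsDag S) {W : BUnit f} (hW : W ∈ S) {y : ℕ} (hy : y ≤ W.round) :
    ∃ V ∈ S, V.round = y := by
  rcases hy.eq_or_lt with rfl | hy
  · exact ⟨W, hW, rfl⟩
  · obtain ⟨Q, hQ, h⟩ := hS.exists_quorum (hS.valid W hW) (hS.closed W hW) hy
    obtain ⟨V, hV⟩ : Q.Nonempty := by
      rw [← Finset.card_pos]; omega
    exact ⟨V, h V hV⟩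

/-- `2 f + 1` and `f + 1` units of the same round have a unit in common. -/
lemma quorum_inter (hS : IsDag S) {Q Q' : Finset (BUnit f)} {y : ℕ}
    (hQ : ∀ V ∈ Q, V ∈ S ∧ V.round = y) (hQ' : ∀ V ∈ Q', V ∈ S ∧ V.round = y)
    (hc : 2 * f + 1 ≤ Q.card) (hc' : f + 1 ≤ Q'.card) : ∃ V ∈ Q, V ∈ Q' := by
  have h1 : (Q ∪ Q').card ≤ 3 * f + 1 := hS.card_le (y := y) fun V hV =>
    (Finset.mem_union.1 hV).elim (hQ V) (hQ' V)
  have h2 := Finset.card_union_add_card_inter Q Q'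
  obtain ⟨V, hV⟩ : (Q ∩ Q').Nonempty := by rw [← Finset.card_pos]; omega
  exact ⟨V, Finset.mem_inter.1 hV⟩

lemma exists_honest (hS : IsDag S) {Q : Finset (BUnit f)} {honest : Finset (Node f)} {y : ℕ}
    (hh : 2 * f + 1 ≤ honest.card)
    (hQ : ∀ V ∈ Q, V ∈ S ∧ V.round = y) (hc : 2 * f + 1 ≤ Q.card) :
    ∃ V ∈ Q, V.creator ∈ honest := by
  by_contra! hcon
  have h1 : Q.card ≤ honestᶜ.card := Finset.card_le_card_of_injOn BUnit.creator
    (fun V hV => by simpa using hcon V hV) (hS.injOn_creator hQ)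
  have h2 := Finset.card_compl_add_card honest
  rw [Fintype.card_fin] at h2
  omega

end IsDag

/-! ### Invariants of executions -/

section Execution

variable (honest : Finset (Node f)) (adv : Adversary f lam)

/-- The invariants of a reachable state. -/
structure Config.IsConsistent (c : Config f lam) : Prop where
  /-- The units broadcast so far form a DAG without forks. -/
  isDag : IsDag (c.units : Set (BUnit f))
  /-- Local copies consist of units that were broadcast. -/
  copy_subset : ∀ i, c.copy i ⊆ c.units
  /-- Local copies of honest nodes contain the parents of their units. -/
  copy_closed : ∀ i ∈ honest, ∀ U ∈ c.copy i, ∀ V ∈ U.parents, V ∈ c.copy i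

lemma isConsistent_step (H : Oracle f lam) {c : Config f lam} (hc : c.IsConsistent honest)
    (a : Action f) : (step honest H c a).IsConsistent honest := by
  cases a with
  | create U =>
    by_cases h : CanCreate honest c U
    · have e : step honest H c (.create U) =
        { units := insert U c.units
          copy := Function.update c.copy U.creator (insert U (c.copy U.creator))
          log := (.create U, none) :: c.log } := if_pos h
      rw [e]
      obtain ⟨hv, hp, hf, hr⟩ := h
      refine ⟨⟨?_, ?_, ?_⟩, ?_, ?_⟩
      · intro W hW V hV
        simp only [Finset.coe_insert, Set.mem_insert_iff, Finset.mem_coe] at hW ⊢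
        rcases hW with rfl | hW
        · exact .inr (hp hV)
        · exact .inr (hc.isDag.closed W hW V hV)
      · intro W hW
        simp only [Finset.coe_insert, Set.mem_insert_iff, Finset.mem_coe] at hW
        rcases hW with rfl | hW
        · exact hv
        · exact hc.isDag.valid W hW
      · intro W hW V hV
        simp only [Finset.coe_insert, Set.mem_insert_iff, Finset.mem_coe] at hW hV
        rcases hW with rfl | hW <;> rcases hV with rfl | hV
        · exact fun _ _ => rfl
        · exact fun h1 h2 => absurd h2.symm (hf V hV h1.symm)
        · exact fun h1 h2 => absurd h2 (hf W hW h1)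
        · exact hc.isDag.noFork W hW V hV
      · intro i
        dsimp only
        by_cases hi : i = U.creator
        · subst hi
          rw [Function.update_self]
          exact Finset.insert_subset_insert _ (hc.copy_subset _)
        · rw [Function.update_of_ne hi]
          exact (hc.copy_subset i).trans (Finset.subset_insert _ _)
      · intro i hi W hW V hV
        dsimp only at hW ⊢
        by_cases hi' : i = U.creator
        · subst hi'
          rw [Function.update_self] at hW ⊢
          rcases Finset.mem_insert.1 hW with rfl | hW
          · exact Finset.mem_insert_of_mem (((hr hi).2.2 V).1 hV).1
          · exact Finset.mem_insert_of_mem (hc.copy_closed _ hi W hW V hV)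
        · rw [Function.update_of_ne hi'] at hW ⊢
          exact hc.copy_closed i hi W hW V hV
    · have e : step honest H c (.create U) =
        { c with log := (.create U, none) :: c.log } := if_neg h
      rw [e]
      exact ⟨hc.isDag, hc.copy_subset, hc.copy_closed⟩
  | deliver j U =>
    by_cases h : CanDeliver c j U
    · have e : step honest H c (.deliver j U) =
        { c with
          copy := Function.update c.copy j (insert U (c.copy j))
          log := (.deliver j U, none) :: c.log } := if_pos h
      rw [e]
      refine ⟨hc.isDag, ?_, ?_⟩
      · intro i
        dsimp only
        by_cases hi : i = j
        · subst hi
          rw [Function.update_self]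
          exact Finset.insert_subset h.1 (hc.copy_subset _)
        · rw [Function.update_of_ne hi]
          exact hc.copy_subset i
      · intro i hi W hW V hV
        dsimp only at hW ⊢
        by_cases hi' : i = j
        · subst hi'
          rw [Function.update_self] at hW ⊢
          rcases Finset.mem_insert.1 hW with rfl | hW
          · exact Finset.mem_insert_of_mem (h.2 hV)
          · exact Finset.mem_insert_of_mem (hc.copy_closed _ hi W hW V hV)
        · rw [Function.update_of_ne hi'] at hW ⊢
          exact hc.copy_closed i hi W hW V hV
    · have e : step honest H c (.deliver j U) =
        { c with log := (.deliver j U, none) :: c.log } := if_neg h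
      rw [e]
      exact ⟨hc.isDag, hc.copy_subset, hc.copy_closed⟩
  | ask q => exact ⟨hc.isDag, hc.copy_subset, hc.copy_closed⟩

lemma isConsistent_run (H : Oracle f lam) (t : ℕ) :
    (run honest adv H t).IsConsistent honest := by
  induction t with
  | zero => constructor <;> simp [run]; constructor <;> simp
  | succ t ih => exact isConsistent_step honest H ih _

lemma mem_units_step {H : Oracle f lam} {c : Config f lam} {a : Action f} {U : BUnit f}
    (hU : U ∈ (step honest H c a).units) : U ∈ c.units ∨ CanCreate honest c U := by
  cases a with
  | create W =>
    by_cases h : CanCreate honest c W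
    · simp only [step, if_pos h, Finset.mem_insert] at hU
      rcases hU with rfl | hU
      · exact .inr h
      · exact .inl hU
    · simp only [step, if_neg h] at hU
      exact .inl hU
  | deliver j W =>
    by_cases h : CanDeliver c j W
    · simp only [step, if_pos h] at hU; exact .inl hU
    · simp only [step, if_neg h] at hU; exact .inl hU
  | ask q => exact .inl hU

lemma units_subset_step (H : Oracle f lam) (c : Config f lam) (a : Action f) :
    c.units ⊆ (step honest H c a).units := by
  cases a with
  | create W =>
    by_cases h : CanCreate honest c W
    · simp only [step, if_pos h]; exact Finset.subset_insert _ _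
    · simp only [step, if_neg h]; exact subset_rfl
  | deliver j W =>
    by_cases h : CanDeliver c j W
    · simp only [step, if_pos h]; exact subset_rfl
    · simp only [step, if_neg h]; exact subset_rfl
  | ask q => exact subset_rfl

lemma units_monotone (H : Oracle f lam) : Monotone fun t => (run honest adv H t).units :=
  monotone_nat_of_le_succ fun _ => units_subset_step honest H _ _

/-- The units that are broadcast at some time of the execution. -/
def created (H : Oracle f lam) : Set (BUnit f) := {U | ∃ t, U ∈ (run honest adv H t).units}

/-- Some honest node has created a unit of round at least `s`. -/
def Reached (s : ℕ) (c : Config f lam) : Prop :=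
  ∃ V ∈ c.units, V.creator ∈ honest ∧ s ≤ V.round

/-- The units that are broadcast before some honest node creates a unit of round at least `s`. At
that time the adversary knows nothing about the secrets of rounds `≥ s`. -/
def early (s : ℕ) (H : Oracle f lam) : Set (BUnit f) :=
  {U | ∃ t, U ∈ (run honest adv H t).units ∧ ¬ Reached honest s (run honest adv H t)}

lemma isDag_created (H : Oracle f lam) : IsDag (created honest adv H) := by
  refine ⟨?_, ?_, ?_⟩
  · rintro U ⟨t, hU⟩ V hV
    exact ⟨t, (isConsistent_run honest adv H t).isDag.closed U hU V hV⟩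
  · rintro U ⟨t, hU⟩
    exact (isConsistent_run honest adv H t).isDag.valid U hU
  · rintro U ⟨t, hU⟩ V ⟨t', hV⟩
    exact (isConsistent_run honest adv H (max t t')).isDag.noFork U
      (units_monotone honest adv H (le_max_left t t') hU) V
      (units_monotone honest adv H (le_max_right t t') hV)

lemma early_subset_created (s : ℕ) (H : Oracle f lam) :
    early honest adv s H ⊆ created honest adv H := fun _ ⟨t, h, _⟩ => ⟨t, h⟩

lemma isDag_early (s : ℕ) (H : Oracle f lam) : IsDag (early honest adv s H) := by
  refine (isDag_created honest adv H).mono (early_subset_created honest adv s H) ?_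
  rintro U ⟨t, hU, ht⟩ V hV
  exact ⟨t, (isConsistent_run honest adv H t).isDag.closed U hU V hV, ht⟩

lemma coe_copy_subset_created (H : Oracle f lam) (t : ℕ) (i : Node f) :
    ((run honest adv H t).copy i : Set (BUnit f)) ⊆ created honest adv H :=
  fun _ hU => ⟨t, (isConsistent_run honest adv H t).copy_subset i hU⟩

lemma isDag_copy (H : Oracle f lam) (t : ℕ) {i : Node f} (hi : i ∈ honest) :
    IsDag ((run honest adv H t).copy i : Set (BUnit f)) :=
  (isDag_created honest adv H).mono (coe_copy_subset_created honest adv H t i)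
    fun U hU V hV => (isConsistent_run honest adv H t).copy_closed i hi U hU V hV

/-- Until an honest node creates a unit of round at least `s`, the execution depends only on the
oracle values at secrets of rounds `< s`. -/
lemma run_congr {s : ℕ} {H H' : Oracle f lam} (h : AgreeBelow s H H') (t : ℕ)
    (ht : ¬ Reached honest s (run honest adv H t)) :
    run honest adv H' t = run honest adv H t := by
  induction t with
  | zero => rfl
  | succ t ih =>
    have ht' : ¬ Reached honest s (run honest adv H t) := fun ⟨V, hV, hV'⟩ =>
      ht ⟨V, units_monotone honest adv H (Nat.le_succ t) hV, hV'⟩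
    have e := ih ht'
    simp only [run, e]
    cases adv (run honest adv H t) with
    | create U => rfl
    | deliver i U => rfl
    | ask q =>
      by_cases hq : Revealed honest (run honest adv H t) q.1
      · have : q.1 < s := by
          by_contra! hs
          obtain ⟨V, hV, hh, hr⟩ := hq
          exact ht' ⟨V, hV, hh, hr ▸ hs⟩
        simp only [step, h q this]
      · simp only [step, if_neg hq]

lemma early_subset_early {s : ℕ} {H H' : Oracle f lam} (h : AgreeBelow s H H') :
    early honest adv s H ⊆ early honest adv s H' := by
  rintro U ⟨t, hU, ht⟩
  have e := run_congr honest adv h t ht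
  exact ⟨t, by rw [e]; exact ⟨hU, ht⟩⟩

lemma early_congr {s : ℕ} {H H' : Oracle f lam} (h : AgreeBelow s H H') :
    early honest adv s H = early honest adv s H' :=
  (early_subset_early honest adv h).antisymm (early_subset_early honest adv h.symm)

/-- Events that are described by the state at time `t` and by further measurable conditions are
measurable: each step uses at most one oracle value. -/
lemma measurableSet_run (t : ℕ) (P : Config f lam → Oracle f lam → Prop)
    (hP : ∀ c, MeasurableSet {H | P c H}) : MeasurableSet {H | P (run honest adv H t) H} := by
  induction t generalizing P with
  | zero => exact hP _
  | succ t ih =>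
    refine ih (fun c H => P (step honest H c (adv c)) H) fun c => ?_
    cases adv c with
    | create U => exact hP _
    | deliver i U => exact hP _
    | ask q =>
      by_cases hq : Revealed honest c q.1
      · have : {H | P (step honest H c (.ask q)) H} = ⋃ x : Hash lam, {H | H q = x} ∩
            {H | P { c with log := (.ask q, some x) :: c.log } H} := by
          ext H
          simp [step, hq]
        rw [this]
        refine MeasurableSet.iUnion fun x => MeasurableSet.inter ?_ (hP _)
        exact measurableSet_of_finset {q} _ fun H H' h hH => by
          rw [← h q (Finset.mem_singleton_self q)]; exact hH
      · simp only [step, if_neg hq]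
        exact hP _

lemma measurableSet_mem_early (s : ℕ) (U : BUnit f) :
    MeasurableSet {H | U ∈ early honest adv s H} := by
  have : {H | U ∈ early honest adv s H} = ⋃ t, {H | U ∈ (run honest adv H t).units ∧
      ¬ Reached honest s (run honest adv H t)} := by
    ext H; simp [early]
  rw [this]
  exact MeasurableSet.iUnion fun t => measurableSet_run honest adv t
    (fun c _ => U ∈ c.units ∧ ¬ Reached honest s c) fun c => MeasurableSet.const _

/-- If a unit of round greater than `s` is ever broadcast, then `2 f + 1` units of each round `< s`
are broadcast before the secrets of rounds `≥ s` are revealed. -/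
lemma exists_early_quorum (hh : 2 * f + 1 ≤ honest.card) {H : Oracle f lam} {W : BUnit f}
    (hW : W ∈ created honest adv H) {s y : ℕ} (hs : s < W.round) (hy : y < s) :
    ∃ Q : Finset (BUnit f), 2 * f + 1 ≤ Q.card ∧
      ∀ V ∈ Q, V ∈ early honest adv s H ∧ V.round = y := by
  have hD := isDag_created honest adv H
  have hex : ∃ t, Reached honest s (run honest adv H t) := by
    obtain ⟨Q, hQ, hQ'⟩ := hD.exists_quorum (hD.valid W hW) (hD.closed W hW) hs
    obtain ⟨V, hV, hVh⟩ := hD.exists_honest hh hQ' hQ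
    obtain ⟨⟨t, ht⟩, hr⟩ := hQ' V hV
    exact ⟨t, V, ht, hVh, hr.ge⟩
  -- The unit created in the step that ends the early phase is honest, of round at least `s`, and
  -- all its parents are early.
  obtain ⟨t, ht⟩ : ∃ t, Nat.find hex = t + 1 := by
    refine Nat.exists_eq_succ_of_ne_zero fun h0 => ?_
    have := Nat.find_spec hex
    rw [h0] at this
    obtain ⟨V, hV, _⟩ := this
    simp [run] at hV
  have h1 := Nat.find_spec hex
  rw [ht] at h1
  have h2 : ¬ Reached honest s (run honest adv H t) := Nat.find_min hex (by omega)
  obtain ⟨V, hV, hVh, hr⟩ := h1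
  rcases mem_units_step honest (hU := hV) with hV | hV
  · exact absurd ⟨V, hV, hVh, hr⟩ h2
  · exact (isDag_early honest adv s H).exists_quorum hV.1 (fun X hX => ⟨t, hV.2.1 hX, h2⟩)
      (hy.trans_le hr)

end Execution

/-! ### Virtual voting -/

/-- The common vote once all secrets are available. -/
def coinVote (H : Oracle f lam) (U₀ : BUnit f) (s : ℕ) : Bool :=
  if s ≤ U₀.round + 3 then true else if s = U₀.round + 4 then false else coin s H

/-- The vote once all secrets are available, defined by the same recursion as `vote`. -/
noncomputable def finalVote (H : Oracle f lam) (U₀ : BUnit f) : BUnit f → Bool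
  | .mk c d k p =>
    if (BUnit.mk c d k p).round ≤ U₀.round + 1 then
      decide (BUnit.Below U₀ (.mk c d k p))
    else
      let A : Set Bool :=
        {v | ∃ i, (p i).round + 1 = (BUnit.mk c d k p).round ∧ finalVote H U₀ (p i) = v}
      if A = {true} then true
      else if A = {false} then false
      else coinVote H U₀ (BUnit.mk c d k p).round

variable (H : Oracle f lam) (U₀ : BUnit f)

lemma commonVote_eq {D : Finset (BUnit f)} {s : ℕ} (h : ∃ V ∈ D, V.round = s + 1) :
    commonVote H D U₀ s = some (coinVote H U₀ s) := by
  unfold commonVote coinVote secretBits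
  rw [if_pos h]
  split_ifs <;> rfl

lemma vote_eq_finalVote {D : Finset (BUnit f)} (U : BUnit f)
    (h : ∀ s ≤ U.round, ∃ V ∈ D, V.round = s + 1) :
    vote H D U₀ U = some (finalVote H U₀ U) := by
  induction U with
  | mk c d k p ih =>
    have ih' : ∀ i, vote H D U₀ (p i) = some (finalVote H U₀ (p i)) := fun i => ih i fun s hs =>
      h s (hs.trans (BUnit.round_lt_of_mem_parents (BUnit.mem_parents_mk.2 ⟨i, rfl⟩)).le)
    unfold vote finalVote
    by_cases h1 : (BUnit.mk c d k p).round ≤ U₀.round + 1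
    · rw [if_pos h1, if_pos h1]
    · rw [if_neg h1, if_neg h1]
      have hA : ∀ b, ({v | ∃ i, (p i).round + 1 = (BUnit.mk c d k p).round ∧
            vote H D U₀ (p i) = v} = ({some b} : Set (Option Bool))) ↔
          {v | ∃ i, (p i).round + 1 = (BUnit.mk c d k p).round ∧ finalVote H U₀ (p i) = v} =
            ({b} : Set Bool) := by
        intro b
        rw [← Set.image_singleton, ← (Option.some_injective Bool).image_injective.eq_iff]
        convert Iff.rfl using 2
        ext v
        simp only [ih', Set.mem_image, Set.mem_ofPred_eq]
        constructor
        · rintro ⟨w, ⟨i, hi, rfl⟩, rfl⟩; exact ⟨i, hi, rfl⟩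
        · rintro ⟨i, hi, rfl⟩; exact ⟨_, ⟨i, hi, rfl⟩, rfl⟩
      simp only [hA, commonVote_eq H U₀ (h _ le_rfl)]
      split_ifs <;> rfl

lemma finalVote_of_round_le {U : BUnit f} (h : U.round ≤ U₀.round + 1) :
    finalVote H U₀ U = decide (BUnit.Below U₀ U) := by
  cases U with
  | mk c d k p => unfold finalVote; rw [if_pos h]

/-- A unit votes `v` if `v` is one of the votes below it and is either unanimous or the common
vote. -/
lemma finalVote_eq {U : BUnit f} (h : U₀.round + 2 ≤ U.round) {v : Bool}
    (hv : ∃ V ∈ U.down, finalVote H U₀ V = v)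
    (h' : coinVote H U₀ U.round = v ∨ ∀ V ∈ U.down, finalVote H U₀ V = v) :
    finalVote H U₀ U = v := by
  cases U with
  | mk c d k p =>
    set A : Set Bool :=
      {v | ∃ i, (p i).round + 1 = (BUnit.mk c d k p).round ∧ finalVote H U₀ (p i) = v} with hA
    have hdef : finalVote H U₀ (BUnit.mk c d k p) = if A = {true} then true
      else if A = {false} then false else coinVote H U₀ (BUnit.mk c d k p).round := by
      rw [finalVote, if_neg (by omega)]
    have hmem : ∀ b, b ∈ A ↔ ∃ V ∈ (BUnit.mk c d k p).down, finalVote H U₀ V = b := by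
      intro b
      simp only [hA, Set.mem_ofPred_eq, BUnit.mem_down, BUnit.mem_parents_mk]
      constructor
      · rintro ⟨i, h1, h2⟩; exact ⟨p i, ⟨⟨i, rfl⟩, h1⟩, h2⟩
      · rintro ⟨V, ⟨⟨i, rfl⟩, h1⟩, h2⟩; exact ⟨i, h1, h2⟩
    have hvA : v ∈ A := (hmem v).2 hv
    rw [hdef]
    rcases h' with h' | h'
    · split_ifs with h1 h2
      · rw [h1] at hvA; exact hvA.symm
      · rw [h2] at hvA; exact hvA.symm
      · exact h'
    · have : A = {v} := by
        refine Set.eq_singleton_iff_unique_mem.2 ⟨hvA, fun b hb => ?_⟩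
        obtain ⟨V, hV, rfl⟩ := (hmem b).1 hb
        exact h' V hV
      cases v <;> simp [this]

lemma finalVote_congr {H H' : Oracle f lam} (U : BUnit f)
    (h : ∀ s ≤ U.round, coin s H = coin s H') : finalVote H U₀ U = finalVote H' U₀ U := by
  induction U with
  | mk c d k p ih =>
    have ih' : ∀ i, finalVote H U₀ (p i) = finalVote H' U₀ (p i) := fun i => ih i fun s hs =>
      h s (hs.trans (BUnit.round_lt_of_mem_parents (BUnit.mem_parents_mk.2 ⟨i, rfl⟩)).le)
    unfold finalVote
    simp only [ih', coinVote, h _ le_rfl]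

lemma measurableSet_finalVote (U : BUnit f) :
    MeasurableSet {H : Oracle f lam | finalVote H U₀ U = true} :=
  measurableSet_of_finset ((Finset.range (U.round + 1)).image fun s => (s, none)) _
    fun H H' h hH => by
      rw [← hH]
      refine (finalVote_congr U₀ U fun s hs => ?_).symm
      rw [coin, coin, h (s, none) (Finset.mem_image_of_mem _ (by simpa [Nat.lt_succ_iff] using hs))]

/-- All units of round `s` in `S` vote `v` on `U₀`. -/
def Aligned (S : Set (BUnit f)) (s : ℕ) (v : Bool) : Prop :=
  ∀ U ∈ S, U.round = s → finalVote H U₀ U = v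

variable {H U₀} {S : Set (BUnit f)}

/-- If `f + 1` units of the previous round vote for the common vote, no unit can see a unanimous
opposite vote. -/
lemma aligned_of_quorum (hS : IsDag S) {s : ℕ} (hs : U₀.round + 2 ≤ s) {v : Bool}
    {Q : Finset (BUnit f)} (hQ : ∀ V ∈ Q, V ∈ S ∧ V.round + 1 = s ∧ finalVote H U₀ V = v)
    (hc : f + 1 ≤ Q.card) (hv : coinVote H U₀ s = v) : Aligned H U₀ S s v := by
  rintro U hU rfl
  obtain ⟨V, hV, hVQ⟩ := hS.quorum_inter (Q := U.down) (Q' := Q) (y := U.round - 1)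
    (fun V hV => by
      rw [BUnit.mem_down] at hV
      exact ⟨hS.closed U hU V hV.1, by omega⟩)
    (fun V hV => ⟨(hQ V hV).1, by have := (hQ V hV).2.1; omega⟩)
    ((hS.valid U hU).2.resolve_left (by omega)) hc
  exact finalVote_eq H U₀ hs ⟨V, hV, (hQ V hVQ).2.2⟩ (.inl hv)

lemma Aligned.mono (hS : IsDag S) {s s' : ℕ} (hs : U₀.round + 1 ≤ s) {v : Bool}
    (h : Aligned H U₀ S s v) (hss : s ≤ s') : Aligned H U₀ S s' v := by
  induction s', hss using Nat.le_induction with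
  | base => exact h
  | succ s' hss ih =>
    intro U hU hr
    have hall : ∀ V ∈ U.down, finalVote H U₀ V = v := fun V hV => by
      rw [BUnit.mem_down] at hV
      exact ih V (hS.closed U hU V hV.1) (by omega)
    obtain ⟨V, hV⟩ : U.down.Nonempty := by
      rw [← Finset.card_pos]
      exact (Nat.succ_pos _).trans_le ((hS.valid U hU).2.resolve_left (by omega))
    exact finalVote_eq H U₀ (by omega) ⟨V, hV, hall V hV⟩ (.inr hall)

/-- Once all units of a round vote `v`, the first later common vote `v` makes every local copy that
is high enough decide `v`. -/
lemma Aligned.exists_unitDecide (hS : IsDag S) {s s' : ℕ} (hs : U₀.round + 1 ≤ s) {v : Bool}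
    (h : Aligned H U₀ S s v) (hss : s < s') (hv : coinVote H U₀ s' = v)
    {D : Finset (BUnit f)} (hD : IsDag (D : Set (BUnit f))) (hDS : (D : Set (BUnit f)) ⊆ S)
    {W : BUnit f} (hW : W ∈ D) (hWs : s' < W.round) :
    ∃ U ∈ D, unitDecide H D U₀ U = some v := by
  have hrounds : ∀ y ≤ s', ∃ V ∈ D, V.round = y + 1 := fun y hy =>
    hD.exists_round_eq hW (by omega)
  obtain ⟨U, hU, rfl⟩ := hD.exists_round_eq hW hWs.le
  refine ⟨U, hU, ?_⟩
  rw [unitDecide, if_neg (by omega), commonVote_eq H U₀ (hrounds _ le_rfl), hv]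
  have hfil : (U.down.filter fun V => vote H D U₀ V = some v) = U.down := by
    refine Finset.filter_true_of_mem fun V hV => ?_
    rw [BUnit.mem_down] at hV
    rw [vote_eq_finalVote H U₀ V fun y hy => hrounds y (by omega),
      h.mono hS hs (s' := V.round) (by omega) V (hDS (hD.closed U hU V hV.1)) rfl]
  dsimp only
  rw [hfil, if_pos ((hD.valid U hU).2.resolve_left (by omega))]

lemma decideUnit_ne_none {D : Finset (BUnit f)} {v : Bool}
    (h : ∃ U ∈ D, unitDecide H D U₀ U = some v) : decideUnit H D U₀ ≠ none := by
  unfold decideUnit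
  cases v
  · split_ifs <;> simp
  · rw [if_pos h]; simp

/-! ### Heads and the linear order -/

section Heads

variable {H : Oracle f lam} {D : Finset (BUnit f)}

lemma exists_undecided_of_firstPositive {R : BUnit f → BUnit f → Prop} {L : List (BUnit f)}
    (hL : L.Pairwise R) (hn : firstPositive H D L = none)
    (hV : ∃ V ∈ L, decideUnit H D V = some true) :
    ∃ U ∈ L, decideUnit H D U = none ∧ ∀ V ∈ L, decideUnit H D V = some true → R U V := by
  induction L with
  | nil => simp at hV
  | cons a L ih =>
    rw [List.pairwise_cons] at hL
    unfold firstPositive at hn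
    split at hn
    · simp at hn
    · rename_i ha
      obtain ⟨V, hVL, hV⟩ := hV
      have hVL' : V ∈ L := (List.mem_cons.1 hVL).resolve_left (by rintro rfl; simp [ha] at hV)
      obtain ⟨U, hU, hU', h⟩ := ih hL.2 hn ⟨V, hVL', hV⟩
      refine ⟨U, List.mem_cons_of_mem _ hU, hU', fun W hW hWd => h W ?_ hWd⟩
      exact (List.mem_cons.1 hW).resolve_left (by rintro rfl; simp [ha] at hWd)
    · rename_i ha
      refine ⟨a, List.mem_cons_self, ha, fun W hW hWd => hL.1 W ?_⟩
      exact (List.mem_cons.1 hW).resolve_left (by rintro rfl; simp [ha] at hWd)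

lemma mem_of_firstPositive {L : List (BUnit f)} {V : BUnit f} (h : firstPositive H D L = some V) :
    V ∈ L := by
  induction L with
  | nil => simp [firstPositive] at h
  | cons a L ih =>
    unfold firstPositive at h
    split at h
    · obtain rfl := Option.some.inj h; exact List.mem_cons_self
    · exact List.mem_cons_of_mem _ (ih h)
    · simp at h

lemma mem_sortedByPriority {r x : ℕ} {U : BUnit f} :
    U ∈ sortedByPriority H D r x ↔ U ∈ D ∧ U.round = r := by
  simp [sortedByPriority]

/-- The sorting criterion is lexicographic, hence a total preorder even in the presence of ties. -/
lemma pairwise_sortedByPriority (r x : ℕ) :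
    (sortedByPriority H D r x).Pairwise fun U V => H (x, some U) ≤ H (x, some V) := by
  unfold sortedByPriority
  refine (List.pairwise_mergeSort ?_ ?_ _).imp ?_
  · intro U V W h1 h2
    simp only [decide_eq_true_eq] at *
    rcases h1 with h1 | ⟨h1, h1'⟩ <;> rcases h2 with h2 | ⟨h2, h2'⟩
    · exact .inl (h1.trans h2)
    · exact .inl (h2 ▸ h1)
    · exact .inl (h1 ▸ h2)
    · exact .inr ⟨h1.trans h2, h1'.trans h2'⟩
  · intro U V
    simp only [Bool.or_eq_true, decide_eq_true_eq]
    rcases lt_trichotomy (H (x, some U)) (H (x, some V)) with h | h | h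
    · exact .inl (.inl h)
    · exact (le_total U.creator V.creator).imp (fun h' => .inr ⟨h, h'⟩)
        fun h' => .inr ⟨h.symm, h'⟩
    · exact .inr (.inl h)
  · intro U V h
    simp only [decide_eq_true_eq] at h
    rcases h with h | h
    · exact h.le
    · exact h.1.le

/-- If no head is chosen although the priorities are available, then some undecided unit precedes
all units that are decided `1`. -/
lemma exists_undecided_of_chooseHead {r : ℕ} (hs : ∃ W ∈ D, W.round = r + 5)
    (hV : ∃ V ∈ D, V.round = r ∧ decideUnit H D V = some true) (hn : chooseHead H D r = none) :
    ∃ U ∈ D, U.round = r ∧ decideUnit H D U = none ∧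
      ∀ V ∈ D, V.round = r → decideUnit H D V = some true →
        H (r + 4, some U) ≤ H (r + 4, some V) := by
  rw [chooseHead, generatePermutation, secretBits, if_pos hs] at hn
  obtain ⟨U, hU, hU', h⟩ := exists_undecided_of_firstPositive
    (pairwise_sortedByPriority r (r + 4)) hn (by simpa [mem_sortedByPriority, and_assoc] using hV)
  rw [mem_sortedByPriority] at hU
  exact ⟨U, hU.1, hU.2, hU', fun V h1 h2 => h V (mem_sortedByPriority.2 ⟨h1, h2⟩)⟩

lemma mem_of_chooseHead {r : ℕ} {V : BUnit f} (h : chooseHead H D r = some V) : V ∈ D := by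
  rw [chooseHead, Option.bind_eq_some_iff] at h
  obtain ⟨L, hL, hV⟩ := h
  rw [generatePermutation, Option.map_eq_some_iff] at hL
  obtain ⟨x, -, rfl⟩ := hL
  exact (mem_sortedByPriority.1 (mem_of_firstPositive hV)).1

lemma subset_orderLoop (n s : ℕ) (L : List (BUnit f)) : L ⊆ orderLoop H D n s L := by
  induction n generalizing s L with
  | zero => exact List.Subset.refl _
  | succ n ih =>
    unfold orderLoop
    split
    · exact List.Subset.refl _
    · exact List.Subset.trans (List.subset_append_left _ _) (ih _ _)

/-- The head itself is in the list once its batch is appended. -/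
lemma mem_append_batch {V : BUnit f} (hV : V ∈ D) (L : List (BUnit f)) : V ∈ L ++ batch D V L := by
  by_cases h : V ∈ L
  · exact List.mem_append_left _ h
  · refine List.mem_append_right _ ?_
    rw [batch, List.mem_mergeSort, Finset.mem_toList, Finset.mem_filter]
    exact ⟨hV, .inl rfl, h⟩

lemma mem_orderLoop {d n s : ℕ} (hd : d < n) (L : List (BUnit f))
    (h : ∀ j < d, chooseHead H D (s + j) ≠ none) {V : BUnit f}
    (hV : chooseHead H D (s + d) = some V) : V ∈ orderLoop H D n s L := by
  induction d generalizing n s L with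
  | zero =>
    obtain ⟨n, rfl⟩ : ∃ m, n = m + 1 := ⟨n - 1, by omega⟩
    rw [orderLoop]
    rw [add_zero] at hV
    simp only [hV]
    exact subset_orderLoop _ _ _ (mem_append_batch (mem_of_chooseHead hV) L)
  | succ d ih =>
    obtain ⟨n, rfl⟩ : ∃ m, n = m + 1 := ⟨n - 1, by omega⟩
    rw [orderLoop]
    obtain ⟨X, hX⟩ := Option.ne_none_iff_exists'.1 (h 0 (by omega))
    rw [add_zero] at hX
    simp only [hX]
    refine ih (by omega) _ (fun j hj => ?_) ?_
    · rw [add_assoc, add_comm 1 j]; exact h (j + 1) (by omega)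
    · rw [add_assoc, add_comm 1 d]; exact hV

/-- The head of round `r` is ordered as soon as the heads of all rounds up to `r` are chosen. -/
lemma headOrdered_of_forall {r : ℕ} (hr : r ≤ height D)
    (h : ∀ j ≤ r, chooseHead H D j ≠ none) : HeadOrdered H r D := by
  obtain ⟨V, hV⟩ := Option.ne_none_iff_exists'.1 (h r le_rfl)
  refine ⟨V, hV, mem_orderLoop (d := r) (Nat.lt_succ_of_le hr) [] (fun j hj => ?_) ?_⟩
  · rw [zero_add]; exact h j hj.le
  · rw [zero_add]; exact hV

end Heads

/-! ### Measurability of the latency -/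

section Congr

variable {H H' : Oracle f lam} {D : Finset (BUnit f)}

lemma lt_height_of_secretBits {r x : ℕ} (h : secretBits D r = some x) : x < height D := by
  unfold secretBits at h
  split_ifs at h with h'
  obtain ⟨U, hU, hr⟩ := h'
  obtain rfl := Option.some.inj h
  rw [← Nat.succ_le_iff, Nat.succ_eq_add_one, ← hr]
  exact Finset.le_sup (f := BUnit.round) hU

lemma vote_congr (h : commonVote H D = commonVote H' D) : vote H D = vote H' D := by
  funext U₀ U
  induction U with
  | mk c d k p ih =>
    unfold vote
    simp only [ih, h]

lemma commonVote_congr (hc : ∀ s < height D, H (s, none) = H' (s, none)) :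
    commonVote H D = commonVote H' D := by
  funext U₀ s
  have : (secretBits D s).map (fun x => (H (x, none)).firstBit) =
      (secretBits D s).map fun x => (H' (x, none)).firstBit :=
    Option.map_congr fun x hx => by rw [hc x (lt_height_of_secretBits hx)]
  rw [commonVote, commonVote, this]

lemma unitDecide_congr (h : commonVote H D = commonVote H' D) :
    unitDecide H D = unitDecide H' D := by
  funext U₀ U
  unfold unitDecide
  simp only [h, vote_congr h]

lemma decideUnit_congr (h : unitDecide H D = unitDecide H' D) :
    decideUnit H D = decideUnit H' D := by
  funext U₀
  unfold decideUnit
  simp only [h]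

lemma firstPositive_congr (h : decideUnit H D = decideUnit H' D) :
    firstPositive H D = firstPositive H' D := by
  funext L
  induction L with
  | nil => rfl
  | cons a L ih =>
    unfold firstPositive
    simp only [h, ih]

lemma sortedByPriority_congr {x : ℕ} (h : ∀ U ∈ D, H (x, some U) = H' (x, some U)) (r : ℕ) :
    sortedByPriority H D r x = sortedByPriority H' D r x := by
  have := List.map_mergeSort (f := id) (l := (D.filter fun U => U.round = r).toList)
    (r := fun U V => decide (H (x, some U) < H (x, some V) ∨
        H (x, some U) = H (x, some V) ∧ U.creator ≤ V.creator))
    (s := fun U V => decide (H' (x, some U) < H' (x, some V) ∨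
        H' (x, some U) = H' (x, some V) ∧ U.creator ≤ V.creator)) (fun U hU V hV => by
      rw [Finset.mem_toList, Finset.mem_filter] at hU hV
      simp only [id, h U hU.1, h V hV.1])
  rw [List.map_id, List.map_id] at this
  exact this

lemma orderLoop_congr (h : chooseHead H D = chooseHead H' D) :
    orderLoop H D = orderLoop H' D := by
  funext n
  induction n with
  | zero => funext s L; rw [orderLoop, orderLoop]
  | succ n ih =>
    funext s L
    rw [orderLoop, orderLoop, h, ih]

/-- The protocol functions of a local copy `D` depend only on the values of the oracle at secrets of
rounds below the height of `D`, alone or together with units of `D`. -/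
lemma headOrdered_congr (hc : ∀ s < height D, H (s, none) = H' (s, none))
    (hp : ∀ s < height D, ∀ U ∈ D, H (s, some U) = H' (s, some U)) (r : ℕ) :
    HeadOrdered H r D ↔ HeadOrdered H' r D := by
  have h1 := firstPositive_congr (decideUnit_congr (unitDecide_congr (commonVote_congr hc)))
  have h2 : chooseHead H D = chooseHead H' D := by
    funext s
    have : generatePermutation H D s = generatePermutation H' D s :=
      Option.map_congr fun x hx =>
        sortedByPriority_congr (hp x (lt_height_of_secretBits hx)) s
    rw [chooseHead, chooseHead, this, h1]
  rw [HeadOrdered, HeadOrdered, orderUnits, orderUnits, orderLoop_congr h2, h2]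

lemma measurableSet_headOrdered (r : ℕ) (D : Finset (BUnit f)) :
    MeasurableSet {H : Oracle f lam | HeadOrdered H r D} :=
  measurableSet_of_finset ((Finset.range (height D)) ×ˢ (insert none (D.image some))) _
    fun H H' h => (headOrdered_congr
      (fun s hs => h (s, none) (by simp [hs]))
      (fun s hs U hU => h (s, some U) (by simp [hs, hU])) r).1

end Congr

variable (honest : Finset (Node f)) (adv : Adversary f lam)

/-- Every local copy of height `r + l` of an honest node orders the head of round `r`. -/
def AllOrdered (r l : ℕ) (H : Oracle f lam) : Prop :=
  ∀ t : ℕ, ∀ i ∈ honest, height ((run honest adv H t).copy i) = r + l →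
    HeadOrdered H r ((run honest adv H t).copy i)

lemma measurableSet_allOrdered (r l : ℕ) :
    MeasurableSet {H | AllOrdered honest adv r l H} := by
  have : {H | AllOrdered honest adv r l H} = ⋂ t, ⋂ i ∈ honest,
      {H | height ((run honest adv H t).copy i) = r + l →
        HeadOrdered H r ((run honest adv H t).copy i)} := by
    ext H; simp [AllOrdered]
  rw [this]
  refine MeasurableSet.iInter fun t => honest.measurableSet_biInter fun i _ => ?_
  exact measurableSet_run honest adv t
    (fun c H => height (c.copy i) = r + l → HeadOrdered H r (c.copy i)) fun c =>
      (MeasurableSet.const _).imp (measurableSet_headOrdered r _)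

lemma natCast_le_headLatency_iff (r K : ℕ) (H : Oracle f lam) :
    (K : ℕ∞) ≤ headLatency honest adv r H ↔ ∀ l < K, ¬ AllOrdered honest adv r l H := by
  unfold headLatency
  rw [le_sInf_iff]
  constructor
  · intro h l hl hA
    have := h l ⟨l, rfl, hA⟩
    exact absurd (Nat.cast_le.1 this) (by omega)
  · rintro h w ⟨l, rfl, hA⟩
    rw [Nat.cast_le]
    by_contra! hl
    exact h l hl hA

lemma measurableSet_le_headLatency (r K : ℕ) :
    MeasurableSet {H | (K : ℕ∞) ≤ headLatency honest adv r H} := by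
  simp only [natCast_le_headLatency_iff]
  have : {H | ∀ l < K, ¬ AllOrdered honest adv r l H} =
      ⋂ l, ⋂ (_ : l < K), {H | AllOrdered honest adv r l H}ᶜ := by
    ext H; simp
  rw [this]
  exact MeasurableSet.iInter fun l => MeasurableSet.iInter fun _ =>
    (measurableSet_allOrdered honest adv r l).compl

lemma measurable_headLatency (r : ℕ) : Measurable (headLatency honest adv r) := by
  rw [ENat.measurable_iff]
  intro n
  have : headLatency honest adv r ⁻¹' {(n : ℕ∞)} =
      {H | (n : ℕ∞) ≤ headLatency honest adv r H} \
        {H | ((n + 1 : ℕ) : ℕ∞) ≤ headLatency honest adv r H} := by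
    ext H
    simp only [Set.mem_preimage, Set.mem_singleton_iff, Set.mem_sdiff, Set.mem_ofPred_eq]
    generalize headLatency honest adv r H = w
    induction w using ENat.recTopCoe with
    | top => simp
    | coe m => simp only [Nat.cast_le, Nat.cast_inj]; omega
  rw [this]
  exact (measurableSet_le_headLatency honest adv r n).diff
    (measurableSet_le_headLatency honest adv r (n + 1))

/-! ### Guessing the common votes -/

section Guess

variable (honest : Finset (Node f)) (adv : Adversary f lam)

/-- The guess of the common vote of round `s` on `U₀`: a majority vote of the
units of round `s - 1` that are broadcast before the secret of round `s` is revealed. -/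
noncomputable def guess (U₀ : BUnit f) (s : ℕ) (H : Oracle f lam) : Bool :=
  decide (∃ Q : Finset (BUnit f), f + 1 ≤ Q.card ∧
    ∀ V ∈ Q, V ∈ early honest adv s H ∧ V.round + 1 = s ∧ finalVote H U₀ V = true)

lemma measurableSet_guess (U₀ : BUnit f) (s : ℕ) :
    MeasurableSet {H | guess honest adv U₀ s H = true} := by
  have : {H | guess honest adv U₀ s H = true} = ⋃ Q : Finset (BUnit f),
      {_H : Oracle f lam | f + 1 ≤ Q.card} ∩ ⋂ V ∈ Q, ({H | V ∈ early honest adv s H} ∩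
        ({_H | V.round + 1 = s} ∩ {H | finalVote H U₀ V = true})) := by
    ext H; simp [guess]
  rw [this]
  exact MeasurableSet.iUnion fun Q => (MeasurableSet.const _).inter <|
    Q.measurableSet_biInter fun V _ => (measurableSet_mem_early honest adv s V).inter <|
      (MeasurableSet.const _).inter (measurableSet_finalVote U₀ V)

lemma determinedBelow_guess (U₀ : BUnit f) (s : ℕ) :
    DeterminedBelow s {H | guess honest adv U₀ s H = true} := by
  intro H H' h
  simp only [guess, Set.mem_ofPred_eq, decide_eq_true_eq, early_congr honest adv h]
  refine exists_congr fun Q => and_congr_right fun _ => forall₂_congr fun V _ =>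
    and_congr_right fun _ => and_congr_right fun hr => ?_
  rw [finalVote_congr U₀ V fun y hy => ?_]
  rw [coin, coin, h (y, none) (by change y < s; omega)]

variable {honest adv} {H : Oracle f lam}

/-- At least `f + 1` units of round `s - 1` vote as guessed. -/
lemma exists_quorum_guess (hh : 2 * f + 1 ≤ honest.card) (U₀ : BUnit f) {W : BUnit f}
    (hW : W ∈ created honest adv H) {s : ℕ} (hs : s < W.round) (hs0 : 0 < s) :
    ∃ Q : Finset (BUnit f), f + 1 ≤ Q.card ∧ ∀ V ∈ Q, V ∈ created honest adv H ∧
      V.round + 1 = s ∧ finalVote H U₀ V = guess honest adv U₀ s H := by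
  by_cases hg : guess honest adv U₀ s H = true
  · have hg' := hg
    rw [guess, decide_eq_true_eq] at hg
    obtain ⟨Q, hQ, h⟩ := hg
    refine ⟨Q, hQ, fun V hV => ⟨early_subset_created _ _ _ _ (h V hV).1, (h V hV).2.1, ?_⟩⟩
    rw [hg', (h V hV).2.2]
  · obtain ⟨Q, hQ, h⟩ := exists_early_quorum honest adv hh hW hs (y := s - 1) (by omega)
    have h1 : (Q.filter fun V => finalVote H U₀ V = true).card < f + 1 := by
      by_contra! hc
      refine hg (decide_eq_true ⟨_, hc, fun V hV => ?_⟩)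
      rw [Finset.mem_filter] at hV
      exact ⟨(h V hV.1).1, by have := (h V hV.1).2; omega, hV.2⟩
    have h2 := Finset.card_filter_add_card_filter_not (s := Q) fun V => finalVote H U₀ V = true
    refine ⟨Q.filter fun V => ¬ finalVote H U₀ V = true, by omega, fun V hV => ?_⟩
    rw [Finset.mem_filter] at hV
    refine ⟨early_subset_created _ _ _ _ (h V hV.1).1, by have := (h V hV.1).2; omega, ?_⟩
    rw [Bool.not_eq_true] at hg
    rw [hg]; exact Bool.eq_false_iff.2 hV.2

/-- The first right guess aligns the votes on `U₀`, and the second one decides `U₀`. -/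
lemma atMostOneHit_of_decideUnit (hh : 2 * f + 1 ≤ honest.card) {D : Finset (BUnit f)}
    (hD : IsDag (D : Set (BUnit f))) (hDS : (D : Set (BUnit f)) ⊆ created honest adv H)
    {W : BUnit f} (hW : W ∈ D) {U₀ : BUnit f} {a m : ℕ} (ha : U₀.round + 5 ≤ a)
    (ham : a + m ≤ W.round) (hU : decideUnit H D U₀ = none) :
    AtMostOneHit (guess honest adv U₀) a m H := by
  intro s s' h1 h2 h3 hit hit'
  have hS := isDag_created honest adv H
  have hc : ∀ y, a ≤ y → coinVote H U₀ y = coin y H := fun y hy => by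
    rw [coinVote, if_neg (by omega), if_neg (by omega)]
  obtain ⟨Q, hQ, h⟩ := exists_quorum_guess hh U₀ (hDS hW) (s := s) (by omega) (by omega)
  have hal : Aligned H U₀ (created honest adv H) s (guess honest adv U₀ s H) :=
    aligned_of_quorum hS (by omega) h hQ (by rw [hc s h1, hit])
  obtain ⟨Q', hQ', h'⟩ := exists_quorum_guess hh U₀ (hDS hW) (s := s') (by omega) (by omega)
  obtain ⟨V, hV⟩ : Q'.Nonempty := by rw [← Finset.card_pos]; omega
  have hg : guess honest adv U₀ s' H = guess honest adv U₀ s H := by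
    rw [← (h' V hV).2.2]
    exact hal.mono hS (by omega) (s' := V.round) (by have := (h' V hV).2.1; omega) V (h' V hV).1 rfl
  exact decideUnit_ne_none (hal.exists_unitDecide hS (by omega) h2
    (by rw [hc s' (by omega), hit', hg]) hD hDS hW (by omega)) hU

/-- Units that are broadcast too late to be seen before the secret of round `U₀.round + 4` is
revealed are decided `0` by the first `0` among the coins. -/
lemma coin_eq_true_of_late (hh : 2 * f + 1 ≤ honest.card) {D : Finset (BUnit f)}
    (hD : IsDag (D : Set (BUnit f))) (hDS : (D : Set (BUnit f)) ⊆ created honest adv H)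
    {W : BUnit f} (hW : W ∈ D) {U₀ : BUnit f} (hlate : U₀ ∉ early honest adv (U₀.round + 4) H)
    (hU : decideUnit H D U₀ = none) {s : ℕ} (hs : U₀.round + 5 ≤ s) (hsW : s < W.round) :
    coin s H = true := by
  have hS := isDag_created honest adv H
  have hE := isDag_early honest adv (U₀.round + 4) H
  have h1 : Aligned H U₀ (early honest adv (U₀.round + 4) H) (U₀.round + 1) false := by
    intro V hV hr
    rw [finalVote_of_round_le H U₀ hr.le, decide_eq_false_iff_not]
    exact fun hb => hlate (hE.mem_of_below hV hb)
  have h3 := h1.mono hE le_rfl (s' := U₀.round + 3) (by omega)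
  obtain ⟨Q, hQ, h⟩ := exists_early_quorum honest adv hh (hDS hW) (s := U₀.round + 4)
    (y := U₀.round + 3) (by omega) (by omega)
  have hal : Aligned H U₀ (created honest adv H) (U₀.round + 4) false :=
    aligned_of_quorum hS (by omega) (Q := Q)
      (fun V hV => ⟨early_subset_created _ _ _ _ (h V hV).1, by rw [(h V hV).2],
        h3 V (h V hV).1 (h V hV).2⟩) (by omega) (by simp [coinVote])
  by_contra hcoin
  rw [Bool.not_eq_true] at hcoin
  refine decideUnit_ne_none (hal.exists_unitDecide hS (by omega) (s' := s) (by omega) ?_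
    hD hDS hW hsW) hU
  rw [coinVote, if_neg (by omega), if_neg (by omega), hcoin]

end Guess

/-! ### Popular units -/

section Popular

variable (honest : Finset (Node f)) (adv : Adversary f lam)

/-- Before the secret of round `r + 4` is revealed, `f + 1` units of round `r + 1` are above the
unit `U` of round `r`. -/
def Popular (r : ℕ) (U : BUnit f) (H : Oracle f lam) : Prop :=
  U ∈ early honest adv (r + 4) H ∧ U.round = r ∧ ∃ Q : Finset (BUnit f), f + 1 ≤ Q.card ∧
    ∀ V ∈ Q, V ∈ early honest adv (r + 4) H ∧ V.round = r + 1 ∧ U.Below V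

lemma measurableSet_popular (r : ℕ) (U : BUnit f) :
    MeasurableSet {H | Popular honest adv r U H} := by
  have : {H | Popular honest adv r U H} = {H | U ∈ early honest adv (r + 4) H} ∩
      ({_H | U.round = r} ∩ ⋃ Q : Finset (BUnit f), {_H : Oracle f lam | f + 1 ≤ Q.card} ∩
        ⋂ V ∈ Q, ({H | V ∈ early honest adv (r + 4) H} ∩
          {_H | V.round = r + 1 ∧ U.Below V})) := by
    ext H; simp [Popular]
  rw [this]
  exact (measurableSet_mem_early honest adv _ U).inter <| (MeasurableSet.const _).inter <|
    MeasurableSet.iUnion fun Q => (MeasurableSet.const _).inter <|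
    Q.measurableSet_biInter fun V _ => (measurableSet_mem_early honest adv _ V).inter <|
      MeasurableSet.const _

variable {honest adv} {H : Oracle f lam} {r : ℕ}

lemma Popular.mem_copy {U : BUnit f} (hU : Popular honest adv r U H) {D : Finset (BUnit f)}
    (hD : IsDag (D : Set (BUnit f))) (hDS : (D : Set (BUnit f)) ⊆ created honest adv H)
    {W : BUnit f} (hW : W ∈ D) (hr : r + 2 ≤ W.round) : U ∈ D := by
  obtain ⟨-, -, Q, hQ, h⟩ := hU
  obtain ⟨X, hX, hXr⟩ := hD.exists_round_eq hW hr
  have hdown : ∀ V ∈ X.down, V ∈ D ∧ V.round = r + 1 := fun V hV => by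
    rw [BUnit.mem_down] at hV
    exact ⟨hD.closed X hX V hV.1, by omega⟩
  obtain ⟨V, hV, hVQ⟩ := (isDag_created honest adv H).quorum_inter (Q := X.down) (Q' := Q)
    (y := r + 1) (fun V hV => ⟨hDS (hdown V hV).1, (hdown V hV).2⟩)
    (fun V hV => ⟨early_subset_created _ _ _ _ (h V hV).1, (h V hV).2.1⟩)
    ((hD.valid X hX).2.resolve_left (by omega)) hQ
  exact hD.mem_of_below (hdown V hV).1 (h V hVQ).2.2

/-- Popular units are decided `1` by the units of round `r + 3`. -/
lemma Popular.decideUnit_eq {U : BUnit f} (hU : Popular honest adv r U H) {D : Finset (BUnit f)}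
    (hD : IsDag (D : Set (BUnit f))) (hDS : (D : Set (BUnit f)) ⊆ created honest adv H)
    {W : BUnit f} (hW : W ∈ D) (hr : r + 4 ≤ W.round) : decideUnit H D U = some true := by
  obtain ⟨-, rfl, Q, hQ, h⟩ := hU
  have hS := isDag_created honest adv H
  have hal : Aligned H U (created honest adv H) (U.round + 2) true :=
    aligned_of_quorum hS le_rfl (Q := Q)
      (fun V hV => ⟨early_subset_created _ _ _ _ (h V hV).1, by rw [(h V hV).2.1], by
        rw [finalVote_of_round_le H U (h V hV).2.1.le, decide_eq_true_eq]
        exact (h V hV).2.2⟩) hQ (by simp [coinVote])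
  rw [decideUnit, if_pos (hal.exists_unitDecide hS (by omega) (s' := U.round + 3) (by omega)
    (by simp [coinVote]) hD hDS hW (by omega))]

lemma finite_early_round (s r : ℕ) : {U | U ∈ early honest adv s H ∧ U.round = r}.Finite := by
  refine Set.Finite.of_finite_image (f := BUnit.creator) (Set.toFinite _) fun U hU V hV h => ?_
  exact (isDag_early honest adv s H).noFork U hU.1 V hV.1 h (hU.2.trans hV.2.symm)

/-- There are at least `f + 1` popular units: among `2 f + 1` units of round `r + 1`, each has
`2 f + 1` of the at most `3 f + 1` units of round `r` as parents. -/
lemma exists_popular (hh : 2 * f + 1 ≤ honest.card) {W : BUnit f}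
    (hW : W ∈ created honest adv H) (hr : r + 4 < W.round) :
    ∃ P : Finset (BUnit f), f + 1 ≤ P.card ∧ ∀ U ∈ P, Popular honest adv r U H := by
  have hE := isDag_early honest adv (r + 4) H
  obtain ⟨Q₀, hQ₀, h₀⟩ := exists_early_quorum honest adv hh hW hr (y := r + 1) (by omega)
  obtain ⟨Q, hQQ, hQ⟩ := Finset.exists_subset_card_eq hQ₀
  have h : ∀ V ∈ Q, V ∈ early honest adv (r + 4) H ∧ V.round = r + 1 := fun V hV => h₀ V (hQQ hV)
  let E : Finset (BUnit f) := Q.biUnion BUnit.down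
  have hEm : ∀ U ∈ E, U ∈ early honest adv (r + 4) H ∧ U.round = r := by
    intro U hU
    obtain ⟨V, hV, hUV⟩ := Finset.mem_biUnion.1 hU
    rw [BUnit.mem_down] at hUV
    exact ⟨hE.closed V (h V hV).1 U hUV.1, by have := (h V hV).2; omega⟩
  have hEc := hE.card_le hEm
  let above : BUnit f → Finset (BUnit f) := fun U => Q.filter fun V => U ∈ V.down
  let P : Finset (BUnit f) := E.filter fun U => f + 1 ≤ (above U).card
  refine ⟨P, ?_, fun U hU => ?_⟩
  · have hdc : ∑ V ∈ Q, V.down.card = ∑ U ∈ E, (above U).card := by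
      have := Finset.sum_card_bipartiteAbove_eq_sum_card_bipartiteBelow (s := Q) (t := E)
        fun V U => U ∈ V.down
      refine (Finset.sum_congr rfl fun V hV => ?_).trans this
      congr 1
      ext U
      simp only [Finset.mem_bipartiteAbove]
      exact ⟨fun hU => ⟨Finset.mem_biUnion.2 ⟨V, hV, hU⟩, hU⟩, fun hU => hU.2⟩
    have h1 : (2 * f + 1) * (2 * f + 1) ≤ ∑ V ∈ Q, V.down.card := by
      rw [← hQ, ← smul_eq_mul, hQ]
      nth_rw 1 [← hQ]
      exact Finset.card_nsmul_le_sum _ _ _ fun V hV =>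
        (hE.valid V (h V hV).1).2.resolve_left (by have := (h V hV).2; omega)
    have h2 : ∑ U ∈ E, (above U).card ≤ P.card * (2 * f + 1) + (E.filter fun U =>
        ¬ f + 1 ≤ (above U).card).card * f := by
      rw [← Finset.sum_filter_add_sum_filter_not E fun U => f + 1 ≤ (above U).card]
      refine add_le_add (Finset.sum_le_card_nsmul _ _ _ fun U _ => ?_)
        (Finset.sum_le_card_nsmul _ _ _ fun U hU => ?_)
      · rw [← hQ]; exact Finset.card_filter_le _ _
      · have := (Finset.mem_filter.1 hU).2; omega
    have h3 := Finset.card_filter_add_card_filter_not (s := E) fun U => f + 1 ≤ (above U).card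
    rw [hdc] at h1
    by_contra! hP
    change P.card + _ = _ at h3
    generalize (E.filter fun U => ¬ f + 1 ≤ (above U).card).card = x at *
    have h4 : x * f ≤ (3 * f + 1 - P.card) * f := Nat.mul_le_mul_right _ (by omega)
    obtain ⟨y, hy⟩ : ∃ y, 3 * f + 1 = P.card + y := ⟨3 * f + 1 - P.card, by omega⟩
    rw [hy, Nat.add_sub_cancel_left] at h4
    nlinarith
  · obtain ⟨hU, hc⟩ := Finset.mem_filter.1 hU
    refine ⟨(hEm U hU).1, (hEm U hU).2, above U, hc, fun V hV => ?_⟩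
    obtain ⟨hV, hUV⟩ := Finset.mem_filter.1 hV
    exact ⟨(h V hV).1, (h V hV).2, BUnit.below_of_mem_parents (BUnit.mem_down.1 hUV).1⟩

end Popular

/-! ### The probability that no head is chosen -/

section Bad

variable (honest : Finset (Node f)) (adv : Adversary f lam)

/-- Some local copy of height `r + k` of an honest node has no head of round `r`. -/
def NoHead (r k : ℕ) (H : Oracle f lam) : Prop :=
  ∃ t : ℕ, ∃ i ∈ honest, height ((run honest adv H t).copy i) = r + k ∧
    chooseHead H ((run honest adv H t).copy i) r = none

/-- Before the secret of round `r + 4` is revealed, `e` is the set of units of round `r`, and `p`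
the set of the popular ones. -/
def EarlySets (r : ℕ) (e p : Finset (BUnit f)) : Set (Oracle f lam) :=
  {H | ∀ U, (U ∈ e ↔ U ∈ early honest adv (r + 4) H ∧ U.round = r) ∧
    (U ∈ p ↔ Popular honest adv r U H)}

lemma measurableSet_earlySets (r : ℕ) (e p : Finset (BUnit f)) :
    MeasurableSet (EarlySets honest adv r e p) := by
  have : EarlySets honest adv r e p = ⋂ U,
      {H | U ∈ e ↔ U ∈ early honest adv (r + 4) H ∧ U.round = r} ∩
        {H | U ∈ p ↔ Popular honest adv r U H} := by
    ext H; simp [EarlySets]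
  rw [this]
  exact MeasurableSet.iInter fun U => ((MeasurableSet.const _).iff
    ((measurableSet_mem_early honest adv _ U).inter (MeasurableSet.const _))).inter
      ((MeasurableSet.const _).iff (measurableSet_popular honest adv r U))

lemma determinedBelow_earlySets (r : ℕ) (e p : Finset (BUnit f)) :
    DeterminedBelow (r + 4) (EarlySets honest adv r e p) := by
  intro H H' h
  simp only [EarlySets, Popular, Set.mem_ofPred_eq, early_congr honest adv h]

lemma pairwise_disjoint_earlySets (r : ℕ) : Pairwise (Function.onFun Disjoint
    fun x : Finset (BUnit f) × Finset (BUnit f) => EarlySets honest adv r x.1 x.2) := by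
  rintro ⟨e, p⟩ ⟨e', p'⟩ hne
  refine Set.disjoint_left.2 fun H h h' => hne ?_
  refine Prod.ext (Finset.ext fun U => ?_) (Finset.ext fun U => ?_)
  · exact (h U).1.trans (h' U).1.symm
  · exact (h U).2.trans (h' U).2.symm

/-- The early unit `U` precedes all units of `p`, and at most one of the guesses for `U` of the
coins of the rounds `r + 5, …, r + 4 + m` is right. -/
def BadUnit (r m : ℕ) (p : Finset (BUnit f)) (U : BUnit f) : Set (Oracle f lam) :=
  {H | ∀ V ∈ p, H (r + 4, some U) ≤ H (r + 4, some V)} ∩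
    {H | AtMostOneHit (guess honest adv U) (r + 5) m H}

/-- If no head is chosen, then either a late unit is undecided, so that all coins are `1`, or an
early unit that is not popular precedes all popular ones and is undecided. -/
lemma noHead_subset (hh : 2 * f + 1 ≤ honest.card) (r m : ℕ) :
    {H | NoHead honest adv r (m + 5) H} ⊆
      {H | ∀ s, r + 5 ≤ s → s < r + 5 + m → coin s H ≠ false} ∪
      ⋃ x : Finset (BUnit f) × Finset (BUnit f),
        ⋃ (_ : x.1.card ≤ 3 * f + 1 ∧ f + 1 ≤ x.2.card), ⋃ U ∈ x.1 \ x.2,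
          EarlySets honest adv r x.1 x.2 ∩ BadUnit honest adv r m x.2 U := by
  rintro H ⟨t, i, hi, hht, hn⟩
  set D := (run honest adv H t).copy i with hDdef
  have hD : IsDag (D : Set (BUnit f)) := isDag_copy honest adv H t hi
  have hDS : (D : Set (BUnit f)) ⊆ created honest adv H :=
    coe_copy_subset_created honest adv H t i
  obtain ⟨W, hW, hWr⟩ : ∃ W ∈ D, W.round = r + (m + 5) := by
    have hne : D.Nonempty := by
      rw [Finset.nonempty_iff_ne_empty]
      intro h0
      rw [h0] at hht
      simp [height] at hht
    obtain ⟨W, hW, e⟩ := Finset.exists_mem_eq_sup D hne BUnit.round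
    exact ⟨W, hW, e.symm.trans hht⟩
  have hfe := finite_early_round (honest := honest) (adv := adv) (H := H) (r + 4) r
  have hfp : {U | Popular honest adv r U H}.Finite := hfe.subset fun U hU => ⟨hU.1, hU.2.1⟩
  obtain ⟨P, hPc, hP⟩ := exists_popular (r := r) hh (hDS hW) (by omega)
  have hpc : f + 1 ≤ hfp.toFinset.card := hPc.trans <| Finset.card_le_card fun U hU => by
    simpa using hP U hU
  have hpop : ∀ U, Popular honest adv r U H → U ∈ D ∧ decideUnit H D U = some true := fun U hU =>
    ⟨hU.mem_copy hD hDS hW (by omega), hU.decideUnit_eq hD hDS hW (by omega)⟩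
  obtain ⟨V, hV⟩ : P.Nonempty := by rw [← Finset.card_pos]; omega
  obtain ⟨U, hUD, hUr, hU, hfirst⟩ := exists_undecided_of_chooseHead
    (hD.exists_round_eq hW (by omega)) ⟨V, (hpop V (hP V hV)).1, (hP V hV).2.1,
      (hpop V (hP V hV)).2⟩ hn
  by_cases hlate : U ∈ early honest adv (r + 4) H
  · refine .inr ?_
    simp only [Set.mem_iUnion]
    refine ⟨(hfe.toFinset, hfp.toFinset), ⟨?_, hpc⟩, U, ?_, ?_, ?_, ?_⟩
    · exact (isDag_early honest adv (r + 4) H).card_le (y := r) fun V hV => by simpa using hV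
    · rw [Finset.mem_sdiff, Set.Finite.mem_toFinset, Set.Finite.mem_toFinset]
      refine ⟨⟨hlate, hUr⟩, fun hp => ?_⟩
      have := (hpop U hp).2
      rw [hU] at this
      cases this
    · exact fun V => ⟨by simp, by simp⟩
    · intro V hV
      rw [Set.Finite.mem_toFinset] at hV
      exact hfirst V (hpop V hV).1 hV.2.1 (hpop V hV).2
    · exact atMostOneHit_of_decideUnit hh hD hDS hW (by omega) (by omega) hU
  · refine .inl fun s hs1 hs2 => ?_
    rw [coin_eq_true_of_late hh hD hDS hW (by rwa [hUr]) hU (by omega) (by omega)]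
    exact Bool.noConfusion

/-- A union bound over the at most `3 f + 1` early units. -/
lemma measure_earlySets_inter_le (hlam : 0 < lam) (hN : 3 * f + 1 ≤ 2 ^ lam) (r m : ℕ)
    {e p : Finset (BUnit f)} (he : e.card ≤ 3 * f + 1) (hp : f + 1 ≤ p.card) :
    oracleLaw f lam (⋃ U ∈ e \ p, EarlySets honest adv r e p ∩ BadUnit honest adv r m p U) ≤
      oracleLaw f lam (EarlySets honest adv r e p) * (4 * ((m + 1) * (2 ^ m)⁻¹)) := by
  set A := EarlySets honest adv r e p
  set μ := oracleLaw f lam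
  have hAm : MeasurableSet A := measurableSet_earlySets honest adv r e p
  have hAd : DeterminedBelow (r + 4) A := determinedBelow_earlySets honest adv r e p
  have hone : ∀ U ∈ e \ p, μ (A ∩ BadUnit honest adv r m p U) ≤
      μ A * ((p.card + 1 : ℝ≥0∞)⁻¹ + (2 ^ lam : ℝ≥0∞)⁻¹) * ((m + 1) * (2 ^ m)⁻¹) := by
    intro U hU
    rw [Finset.mem_sdiff] at hU
    rw [BadUnit, ← Set.inter_assoc]
    refine (measure_atMostOneHit_le hlam (r + 5) (hAm.inter ?_) ((hAd.mono (by omega)).inter ?_)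
      (fun s _ => measurableSet_guess honest adv U s)
      (fun s _ => determinedBelow_guess honest adv U s) m).2.2.trans ?_
    · exact measurableSet_of_finset ((insert U p).image fun V => (r + 4, some V)) _
        fun H H' h hH V hV => by
          rw [← h _ (Finset.mem_image_of_mem _ (Finset.mem_insert_self U p)),
            ← h _ (Finset.mem_image_of_mem _ (Finset.mem_insert_of_mem hV))]
          exact hH V hV
    · intro H H' h
      refine forall₂_congr fun V _ => ?_
      rw [h (r + 4, some U) (Nat.lt_succ_self _), h (r + 4, some V) (Nat.lt_succ_self _)]
    · gcongr
      exact measure_precedes_le (r + 4) hAm hAd p hU.2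
  have hcard : ((e \ p).card : ℝ≥0∞) ≤ 3 * f + 1 := by
    exact_mod_cast (Finset.card_le_card Finset.sdiff_subset).trans he
  have hconst : (3 * f + 1 : ℝ≥0∞) * ((p.card + 1 : ℝ≥0∞)⁻¹ + (2 ^ lam : ℝ≥0∞)⁻¹) ≤ 4 := by
    have h1 : (3 * f + 1 : ℝ≥0∞) * (p.card + 1 : ℝ≥0∞)⁻¹ ≤ 3 := by
      rw [← div_eq_mul_inv]
      refine ENNReal.div_le_of_le_mul ?_
      exact_mod_cast (by omega : 3 * f + 1 ≤ 3 * (p.card + 1))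
    have h2 : (3 * f + 1 : ℝ≥0∞) * (2 ^ lam : ℝ≥0∞)⁻¹ ≤ 1 := by
      rw [← div_eq_mul_inv]
      refine ENNReal.div_le_of_le_mul ?_
      rw [one_mul]
      exact_mod_cast hN
    rw [mul_add]
    calc _ ≤ (3 : ℝ≥0∞) + 1 := add_le_add h1 h2
      _ = 4 := by norm_num
  calc μ (⋃ U ∈ e \ p, A ∩ BadUnit honest adv r m p U)
      ≤ ∑ U ∈ e \ p, μ (A ∩ BadUnit honest adv r m p U) := measure_biUnion_finset_le _ _
    _ ≤ ∑ _U ∈ e \ p, μ A * ((p.card + 1 : ℝ≥0∞)⁻¹ + (2 ^ lam : ℝ≥0∞)⁻¹) *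
          ((m + 1) * (2 ^ m)⁻¹) := Finset.sum_le_sum hone
    _ = (e \ p).card * (μ A * ((p.card + 1 : ℝ≥0∞)⁻¹ + (2 ^ lam : ℝ≥0∞)⁻¹) *
          ((m + 1) * (2 ^ m)⁻¹)) := by rw [Finset.sum_const, nsmul_eq_mul]
    _ ≤ (3 * f + 1) * (μ A * ((p.card + 1 : ℝ≥0∞)⁻¹ + (2 ^ lam : ℝ≥0∞)⁻¹) *
          ((m + 1) * (2 ^ m)⁻¹)) := by gcongr
    _ = μ A * ((3 * f + 1) * ((p.card + 1 : ℝ≥0∞)⁻¹ + (2 ^ lam : ℝ≥0∞)⁻¹) *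
          ((m + 1) * (2 ^ m)⁻¹)) := by ring
    _ ≤ μ A * (4 * ((m + 1) * (2 ^ m)⁻¹)) := by gcongr

lemma measure_noHead_le_of_five_le (hlam : 0 < lam) (hN : 3 * f + 1 ≤ 2 ^ lam)
    (hh : 2 * f + 1 ≤ honest.card) (r m : ℕ) :
    oracleLaw f lam {H | NoHead honest adv r (m + 5) H} ≤ 5 * ((m + 1) * (2 ^ m)⁻¹) := by
  set μ := oracleLaw f lam
  refine (measure_mono (noHead_subset honest adv hh r m)).trans ((measure_union_le _ _).trans ?_)
  have h1 : μ {H | ∀ s, r + 5 ≤ s → s < r + 5 + m → coin s H ≠ false} ≤ (m + 1) * (2 ^ m)⁻¹ := by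
    have := (measure_noHit_le (f := f) hlam (r + 5) (A := Set.univ) MeasurableSet.univ
      (fun _ _ _ => Iff.rfl) (g := fun _ _ => false) (fun _ _ => MeasurableSet.const _)
      (fun _ _ _ _ _ => Iff.rfl) m).2.2
    rw [Set.univ_inter, measure_univ, one_mul] at this
    refine this.trans ?_
    exact le_mul_of_one_le_left zero_le (by simp)
  have h2 : ∀ x : Finset (BUnit f) × Finset (BUnit f),
      μ (⋃ (_ : x.1.card ≤ 3 * f + 1 ∧ f + 1 ≤ x.2.card), ⋃ U ∈ x.1 \ x.2,
          EarlySets honest adv r x.1 x.2 ∩ BadUnit honest adv r m x.2 U) ≤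
        μ (EarlySets honest adv r x.1 x.2) * (4 * ((m + 1) * (2 ^ m)⁻¹)) := by
    intro x
    by_cases hx : x.1.card ≤ 3 * f + 1 ∧ f + 1 ≤ x.2.card
    · simp only [hx, and_self, Set.iUnion_true]
      exact measure_earlySets_inter_le honest adv hlam hN r m hx.1 hx.2
    · simp only [hx, Set.iUnion_false, measure_empty]
      exact zero_le
  have h3 : ∑' x : Finset (BUnit f) × Finset (BUnit f), μ (EarlySets honest adv r x.1 x.2) ≤ 1 := by
    rw [← measure_iUnion (pairwise_disjoint_earlySets honest adv r)
      fun x => measurableSet_earlySets honest adv r x.1 x.2]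
    exact prob_le_one
  calc _ ≤ (m + 1) * (2 ^ m)⁻¹ + ∑' x : Finset (BUnit f) × Finset (BUnit f),
        μ (EarlySets honest adv r x.1 x.2) * (4 * ((m + 1) * (2 ^ m)⁻¹)) :=
        add_le_add h1 ((measure_iUnion_le _).trans (ENNReal.tsum_le_tsum h2))
    _ ≤ (m + 1) * (2 ^ m)⁻¹ + 1 * (4 * ((m + 1) * (2 ^ m)⁻¹)) := by
        rw [ENNReal.tsum_mul_right]
        gcongr
    _ = 5 * ((m + 1) * (2 ^ m)⁻¹) := by ring

/-- The constant is large enough for the bound to be trivial if `k < 5`. -/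
lemma measure_noHead_le (hlam : 0 < lam) (hN : 3 * f + 1 ≤ 2 ^ lam)
    (hh : 2 * f + 1 ≤ honest.card) (r k : ℕ) :
    oracleLaw f lam {H | NoHead honest adv r k H} ≤ 160 * ((k + 1) * (2 ^ k)⁻¹) := by
  have h2 : ∀ n : ℕ, (2 ^ n : ℝ≥0∞) * (2 ^ n)⁻¹ = 1 := fun n =>
    ENNReal.mul_inv_cancel (by simp) (by simp)
  rcases Nat.lt_or_ge k 5 with hk | hk
  · refine prob_le_one.trans ?_
    calc (1 : ℝ≥0∞) = 2 ^ k * (2 ^ k)⁻¹ := (h2 k).symm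
      _ ≤ (160 * (k + 1)) * (2 ^ k)⁻¹ := by
        gcongr
        have : 2 ^ k ≤ 2 ^ 5 := Nat.pow_le_pow_right (by norm_num) hk.le
        exact_mod_cast (by omega : 2 ^ k ≤ 160 * (k + 1))
      _ = _ := by ring
  · obtain ⟨m, rfl⟩ : ∃ m, k = m + 5 := ⟨k - 5, by omega⟩
    refine (measure_noHead_le_of_five_le honest adv hlam hN hh r m).trans ?_
    have : (2 ^ m : ℝ≥0∞)⁻¹ = 32 * (2 ^ (m + 5))⁻¹ := by
      rw [pow_add, ENNReal.mul_inv (by simp) (by simp), mul_left_comm]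
      have := h2 5
      norm_num at this ⊢
      rw [this, mul_one]
    rw [this]
    calc 5 * (((m : ℝ≥0∞) + 1) * (32 * (2 ^ (m + 5))⁻¹))
        = 160 * ((m + 1) * (2 ^ (m + 5))⁻¹) := by ring
      _ ≤ 160 * (((m + 5 : ℕ) + 1) * (2 ^ (m + 5))⁻¹) := by
        gcongr
        omega

end Bad

/-! ### The tail and the expectation of the latency -/

/-- `∑ (j + 1) 2⁻ʲ = 4`, with the exact remainder. -/
lemma sum_range_mul_inv_two_pow_add (n : ℕ) :
    ∑ j ∈ Finset.range n, ((j : ℝ≥0∞) + 1) * (2 ^ j)⁻¹ + (2 * n + 4) * (2 ^ n)⁻¹ = 4 := by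
  induction n with
  | zero => simp
  | succ n ih =>
    have h : (2 ^ n : ℝ≥0∞)⁻¹ = 2 * (2 ^ (n + 1))⁻¹ := by
      rw [pow_succ, ENNReal.mul_inv (by simp) (by simp), mul_left_comm,
        ENNReal.mul_inv_cancel (by simp) (by simp), mul_one]
    refine Eq.trans ?_ ih
    rw [Finset.sum_range_succ, h]
    push_cast
    ring

lemma sum_range_mul_inv_two_pow_le (n : ℕ) :
    ∑ j ∈ Finset.range n, ((j : ℝ≥0∞) + 1) * (2 ^ j)⁻¹ ≤ 4 :=
  (sum_range_mul_inv_two_pow_add n).le.trans' le_self_add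

/-- Integrating this identity expresses an expectation as the sum of the tails. -/
lemma toENNReal_eq_tsum (w : ℕ∞) :
    (w : ℝ≥0∞) = ∑' n : ℕ, if ((n + 1 : ℕ) : ℕ∞) ≤ w then 1 else 0 := by
  induction w using ENat.recTopCoe with
  | top => simp
  | coe m =>
    rw [tsum_eq_sum (s := Finset.range m) fun n hn => by
      rw [if_neg]; rw [Nat.cast_le]; simpa using hn]
    rw [Finset.sum_congr rfl (g := fun _ => 1) fun n hn => by
      rw [if_pos]; rw [Nat.cast_le]; simpa using hn]
    simp

section Latency

variable (honest : Finset (Node f)) (adv : Adversary f lam)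

/-- If the latency of round `r` exceeds `n`, then at height `r + n` the head of some round `≤ r` has
not been chosen in some local copy. -/
lemma le_headLatency_subset (r n : ℕ) :
    {H | ((n + 1 : ℕ) : ℕ∞) ≤ headLatency honest adv r H} ⊆
      ⋃ j ∈ Finset.range (r + 1), {H | NoHead honest adv (r - j) (j + n) H} := by
  intro H hH
  have := (natCast_le_headLatency_iff honest adv r (n + 1) H).1 hH n (Nat.lt_succ_self n)
  unfold AllOrdered at this
  push Not at this
  obtain ⟨t, i, hi, hht, hno⟩ := this
  obtain ⟨s, hs, hs'⟩ : ∃ s ≤ r, chooseHead H ((run honest adv H t).copy i) s = none := by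
    by_contra! hcon
    exact hno (headOrdered_of_forall (by omega) hcon)
  simp only [Set.mem_iUnion]
  refine ⟨r - s, by simp, t, i, hi, by omega, ?_⟩
  rwa [Nat.sub_sub_self hs]

lemma measure_le_headLatency_le (hlam : 0 < lam) (hN : 3 * f + 1 ≤ 2 ^ lam)
    (hh : 2 * f + 1 ≤ honest.card) (r n : ℕ) :
    oracleLaw f lam {H | ((n + 1 : ℕ) : ℕ∞) ≤ headLatency honest adv r H} ≤
      640 * (((n : ℝ≥0∞) + 1) * (2 ^ n)⁻¹) := by
  calc oracleLaw f lam {H | ((n + 1 : ℕ) : ℕ∞) ≤ headLatency honest adv r H}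
      ≤ ∑ j ∈ Finset.range (r + 1), oracleLaw f lam {H | NoHead honest adv (r - j) (j + n) H} :=
        (measure_mono (le_headLatency_subset honest adv r n)).trans (measure_biUnion_finset_le _ _)
    _ ≤ ∑ j ∈ Finset.range (r + 1),
          160 * (((n : ℝ≥0∞) + 1) * (2 ^ n)⁻¹) * (((j : ℝ≥0∞) + 1) * (2 ^ j)⁻¹) := by
        refine Finset.sum_le_sum fun j _ =>
          (measure_noHead_le honest adv hlam hN hh (r - j) (j + n)).trans ?_
        rw [pow_add, ENNReal.mul_inv (by simp) (by simp)]
        -- `j + n + 1 ≤ (n + 1) (j + 1)` separates the two factors.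
        calc 160 * ((((j + n : ℕ) : ℝ≥0∞) + 1) * ((2 ^ j)⁻¹ * (2 ^ n)⁻¹))
            ≤ 160 * (((n + 1) * (j + 1)) * ((2 ^ j)⁻¹ * (2 ^ n)⁻¹)) := by
              gcongr
              exact_mod_cast (by nlinarith [Nat.zero_le (n * j)] :
                j + n + 1 ≤ (n + 1) * (j + 1))
          _ = _ := by ring
    _ ≤ 160 * (((n : ℝ≥0∞) + 1) * (2 ^ n)⁻¹) * 4 := by
        rw [← Finset.mul_sum]
        gcongr
        exact sum_range_mul_inv_two_pow_le _
    _ = 640 * (((n : ℝ≥0∞) + 1) * (2 ^ n)⁻¹) := by ring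

lemma lintegral_headLatency_le (hlam : 0 < lam) (hN : 3 * f + 1 ≤ 2 ^ lam)
    (hh : 2 * f + 1 ≤ honest.card) (r : ℕ) :
    ∫⁻ H, (headLatency honest adv r H : ℝ≥0∞) ∂(oracleLaw f lam) ≤ 2560 := by
  simp only [toENNReal_eq_tsum]
  rw [lintegral_tsum fun n => (Measurable.ite (measurableSet_le_headLatency honest adv r (n + 1))
    measurable_const measurable_const).aemeasurable]
  have h : ∀ n : ℕ, ∫⁻ H, (if ((n + 1 : ℕ) : ℕ∞) ≤ headLatency honest adv r H then 1 else 0)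
      ∂(oracleLaw f lam) ≤ 640 * (((n : ℝ≥0∞) + 1) * (2 ^ n)⁻¹) := by
    intro n
    refine le_of_eq_of_le ?_ (measure_le_headLatency_le honest adv hlam hN hh r n)
    rw [← lintegral_indicator_one (measurableSet_le_headLatency honest adv r (n + 1))]
    refine lintegral_congr fun H => ?_
    rw [Set.indicator_apply]
    rfl
  refine (ENNReal.tsum_le_tsum h).trans (ENNReal.tsum_le_of_sum_range_le fun n => ?_)
  rw [← Finset.mul_sum]
  calc 640 * ∑ j ∈ Finset.range n, ((j : ℝ≥0∞) + 1) * (2 ^ j)⁻¹ ≤ 640 * 4 := by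
        gcongr; exact sum_range_mul_inv_two_pow_le n
    _ = 2560 := by norm_num

end Latency

end Aleph

theorem theoremD1 :
    ∃ C : ℝ≥0, ∀ f lam : ℕ, 0 < lam → 3 * f + 1 ≤ 2 ^ lam →
      ∀ honest : Finset (Aleph.Node f), 2 * f + 1 ≤ honest.card →
      ∀ (adv : Aleph.Adversary f lam) (r : ℕ),
        Measurable (Aleph.headLatency honest adv r) ∧
        (∀ K : ℕ, 0 < K →
          Aleph.oracleLaw f lam {H | (K : ℕ∞) ≤ Aleph.headLatency honest adv r H} ≤
            (C : ℝ≥0∞) * K * (2 ^ K)⁻¹) ∧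
        ∫⁻ H, (Aleph.headLatency honest adv r H : ℝ≥0∞) ∂(Aleph.oracleLaw f lam) ≤ C := by
  refine ⟨2560, fun f lam hlam hN honest hh adv r =>
    ⟨Aleph.measurable_headLatency honest adv r, fun K hK => ?_,
      Aleph.lintegral_headLatency_le honest adv hlam hN hh r⟩⟩
  obtain ⟨n, rfl⟩ : ∃ n, K = n + 1 := ⟨K - 1, by omega⟩
  refine (Aleph.measure_le_headLatency_le honest adv hlam hN hh r n).trans ?_
  have h : (2 ^ n : ℝ≥0∞)⁻¹ = 2 * (2 ^ (n + 1))⁻¹ := by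
    rw [pow_succ, ENNReal.mul_inv (by simp) (by simp), mul_left_comm,
      ENNReal.mul_inv_cancel (by simp) (by simp), mul_one]
  rw [h]
  calc 640 * (((n : ℝ≥0∞) + 1) * (2 * (2 ^ (n + 1))⁻¹))
      = 1280 * (n + 1) * (2 ^ (n + 1))⁻¹ := by ring
    _ ≤ ((2560 : ℝ≥0) : ℝ≥0∞) * (n + 1 : ℕ) * (2 ^ (n + 1))⁻¹ := by
      push_cast
      gcongr
      norm_num
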